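/- Let $\lambda,\mu>0$ and $\alpha\ge 0$, and let $X(t)$, $t\ge 0$, be a time-homogeneous continuous-time Markov chain on $\mathbf Z$ with right-continuous paths whose only transitions are $k\to k+1$ at rate $\lambda$ and $k\to k-1$ at rate $\mu$ (for all $k\in\mathbf Z$), and $k\to 0$ at rate $\alpha$ (for all $k\ne 0$; rates leading to the same state add up). That is, the transition probabilities $p_{k,n}(t)=P(X(t)=n\mid X(0)=k)$ satisfy $p_{k,n}'(0)=q_{k,n}$, where $Q=(q_{k,n})$ is the corresponding conservative rate matrix. Let $I_n(x)=\sum_{m\ge 0}\frac{(x/2)^{2m+|n|}}{m!\,(m+|n|)!}$, $n\in\mathbf Z$, be the modified Bessel function of the first kind. Then for all $k,n\in\mathbf Z$ and $t\ge 0$ $$p_{k,n}(t)=\Big(\frac{\lambda}{\mu}\Big)^{\frac{n-k}{2}} I_{n-k}(2\sqrt{\lambda\mu}\,t)\,e^{-(\lambda+\mu+\alpha)t}+\alpha\Big(\frac{\lambda}{\mu}\Big)^{\frac n2}\int_0^t e^{-(\lambda+\mu+\alpha)\tau} I_n(2\sqrt{\lambda\mu}\,\tau)\,d\tau .$$ Suppose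 now that $\lambda=\mu$. (a) Let $k\ge 1$. The first-passage time $\inf\{t\ge 0: X(t)=0\}$ of $X$ through $0$, given $X(0)=k$, is almost surely finite and has the probability density $g^-_{k,0}$ on $(0,\infty)$ given by $$g^-_{k,0}(t)=e^{-(2\lambda+\alpha)t}\Big\{\lambda\,[I_{k-1}(2\lambda t)-I_{k+1}(2\lambda t)]+\alpha\sum_{j=1}^{\infty}[I_{k-j}(2\lambda t)-I_{k+j}(2\lambda t)]\Big\},\qquad t>0,$$ where the series converges; given $X(0)=-k$ it has the same density. Moreover, for all $t>0$, $$g^-_{k,0}(t)=h^-_{k,0}(t)-h^+_{k,0}(t)=\lambda\,[p_{k,1}(t)-p_{k,-1}(t)]+\alpha\Big[\sum_{j\ge 1}p_{k,j}(t)-\sum_{i\le -1}p_{k,i}(t)\Big],$$ where $h^-_{k,0}(t)=\lim_{\tau\downarrow 0}\frac1\tau P(X(t+\tau)=0,\,X(t)>0\mid X(0)=k)=\sum_{j\ge 1}p_{k,j}(t)\,q_{j,0}$ and $h^+_{k,0}(t)=\lim_{\tau\downarrow 0}\frac1\tau P(X(t+\tau)=0,\,X(t)<0\mid X(0)=k)=\sum_{i\le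 -1}p_{k,i}(t)\,q_{i,0}$ (these limits exist and the series converge). (b) Let $k,n$ be nonzero integers of the same sign. For all $t>0$, the $0$-avoiding transition probability $p^{\langle 0\rangle}_{k,n}(t)=P(X(t)=n,\ X(\vartheta)\ne 0\text{ for all }\vartheta\in(0,t)\mid X(0)=k)$ is $$p^{\langle 0\rangle}_{k,n}(t)=p_{k,n}(t)-p_{-k,n}(t)=e^{-(2\lambda+\alpha)t}\,[I_{n-k}(2\lambda t)-I_{n+k}(2\lambda t)].$$ -/

import Mathlib

open MeasureTheory Filter Topology
open scoped NNReal ENNReal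

/-- The modified Bessel function of the first kind of integer order `n`,
`I_n(x) = ∑_{m ≥ 0} (x/2)^(2m+|n|) / (m! (m+|n|)!)`  (so that `I_{-n} = I_n`). -/
noncomputable def besselI (n : ℤ) (x : ℝ) : ℝ :=
  ∑' m : ℕ, (x / 2) ^ (2 * m + n.natAbs) / ((m.factorial : ℝ) * ((m + n.natAbs).factorial : ℝ))

/-- The rate matrix on `ℤ` of the bilateral birth-death process with jumps: from every `k`
to `k + 1` at rate `lam`, from every `k` to `k - 1` at rate `mu`, and from every `k ≠ 0`
to `0` at rate `al` (in addition to a possible birth or death leading to `0`). -/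
noncomputable def bdJumpRate (lam mu al : ℝ) (k n : ℤ) : ℝ :=
  if n = k then -(lam + mu + if k = 0 then 0 else al)
  else (if n = k + 1 then lam else 0) + (if n = k - 1 then mu else 0) + (if n = 0 then al else 0)

section Chain

variable {Ω : Type*} [MeasurableSpace Ω]

/-- The transition probability `p_{k,n}(t) = P(X(t) = n | X(0) = k)`; here `P k` is the law
under which the chain starts at `k`. -/
noncomputable def transProb (X : ℝ≥0 → Ω → ℤ) (P : ℤ → Measure Ω) (k n : ℤ) (t : ℝ≥0) : ℝ :=
  (P k).real {ω | X t ω = n}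

/-- `(X, P)` is a time-homogeneous continuous-time Markov chain on `ℤ` with right-continuous
paths and infinitesimal generator `q`, i.e. `q k n` is the derivative at `0` of `p_{k,n}`.
The measure `P k` is the law of the chain started at `k`. -/
structure IsMarkovChainWithGenerator (X : ℝ≥0 → Ω → ℤ) (P : ℤ → Measure Ω)
    (q : ℤ → ℤ → ℝ) : Prop where
  isProbability : ∀ k, IsProbabilityMeasure (P k)
  measurable : ∀ t, Measurable (X t)
  rightContinuous : ∀ ω t, ContinuousWithinAt (fun u => X u ω) (Set.Ici t) t
  start : ∀ k, ∀ᵐ ω ∂(P k), X 0 ω = k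
  markov : ∀ (k : ℤ) (s t : ℝ≥0) (m n : ℤ) (A : Set Ω),
    MeasurableSet[⨆ u : Set.Iic s, MeasurableSpace.comap (X u) ⊤] A →
    P k (A ∩ {ω | X s ω = m} ∩ {ω | X (s + t) ω = n})
      = P k (A ∩ {ω | X s ω = m}) * P m {ω | X t ω = n}
  generator : ∀ k n : ℤ,
    HasDerivWithinAt (fun t : ℝ => transProb X P k n t.toNNReal) (q k n) (Set.Ici 0) 0

/-- The first-passage time to the state `s`, equal to `∞` if `s` is never visited. -/
noncomputable def firstPassageTime (X : ℝ≥0 → Ω → ℤ) (s : ℤ) (ω : Ω) : ℝ≥0∞ :=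
  ⨅ (t : ℝ≥0) (_ : X t ω = s), (t : ℝ≥0∞)

/-- Under `ν` the random time `T` is almost surely finite and has probability density `g`
on `(0, ∞)`. -/
def HasTimeDensity (ν : Measure Ω) (T : Ω → ℝ≥0∞) (g : ℝ → ℝ) : Prop :=
  AEMeasurable T ν ∧ AEMeasurable g (volume.restrict (Set.Ioi 0)) ∧ (∀ t, 0 < t → 0 ≤ g t) ∧
    ν.map T = ((volume.restrict (Set.Ioi (0 : ℝ))).withDensity
      (fun t => ENNReal.ofReal (g t))).map ENNReal.ofReal

/-- The `s`-avoiding transition probability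
`P(X(t) = n, X(θ) ≠ s for all θ ∈ (0, t) | X(0) = k)`. -/
noncomputable def avoidingProb (X : ℝ≥0 → Ω → ℤ) (P : ℤ → Measure Ω) (s k n : ℤ)
    (t : ℝ≥0) : ℝ :=
  (P k).real {ω | X t ω = n ∧ ∀ θ : ℝ≥0, 0 < θ → θ < t → X θ ω ≠ s}

/-- `h` is the upward probability current into `s` at time `t`, the chain starting at `k`:
`h = lim_{τ ↓ 0} τ⁻¹ P(X(t+τ) = s, X(t) < s | X(0) = k)`. -/
def IsUpwardCurrent (X : ℝ≥0 → Ω → ℤ) (P : ℤ → Measure Ω) (k s : ℤ) (t : ℝ≥0)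
    (h : ℝ) : Prop :=
  Tendsto (fun τ : ℝ≥0 => (P k).real {ω | X (t + τ) ω = s ∧ X t ω < s} / (τ : ℝ))
    (𝓝[>] 0) (𝓝 h)

/-- `h` is the downward probability current into `s` at time `t`, the chain starting at `k`:
`h = lim_{τ ↓ 0} τ⁻¹ P(X(t+τ) = s, X(t) > s | X(0) = k)`. -/
def IsDownwardCurrent (X : ℝ≥0 → Ω → ℤ) (P : ℤ → Measure Ω) (k s : ℤ) (t : ℝ≥0)
    (h : ℝ) : Prop :=
  Tendsto (fun τ : ℝ≥0 => (P k).real {ω | X (t + τ) ω = s ∧ s < X t ω} / (τ : ℝ))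
    (𝓝[>] 0) (𝓝 h)

end Chain

/-- The Bessel series
`e^{-(2 lam + al) t} { lam [I_{k-1}(2 lam t) - I_{k+1}(2 lam t)]
  + al ∑_{j ≥ 1} [I_{k-j}(2 lam t) - I_{k+j}(2 lam t)] }`. -/
noncomputable def passageDensity (lam al : ℝ) (k : ℤ) (t : ℝ) : ℝ :=
  Real.exp (-(2 * lam + al) * t) *
    (lam * (besselI (k - 1) (2 * lam * t) - besselI (k + 1) (2 * lam * t))
      + al * ∑' j : ℕ, (besselI (k - (j + 1)) (2 * lam * t)
          - besselI (k + (j + 1)) (2 * lam * t)))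

/-! The jump clock may be run at rate `al` in every state, a jump from `0` to `0` being invisible.
Then either no jump has occurred by time `t`, or the last one occurred some `τ` ago and the chain
has since performed a plain walk from `0`. These two cases give the terms `walkProb` and `jumpProb`.
The proof fixes the target `n` and reads `p_{k,n}(t)` as a function of `k`: it solves the backward
equation (`hasDerivWithinAt_transProb`), the explicit expression solves it too by the recurrence `2
I_n' = I_{n-1} + I_{n+1}`, and bounded solutions are unique (`eq_zero_of_backward_equation`).

For equal rates, `p_{k,0} = p_{-k,0}`. A first-visit decomposition then shows that the first visit
to `0` has the same law from `k` and from `-k`, so `p_{k,n} - p_{-k,n}` is carried by paths that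
avoid `0` (`noVisit_sub_eq`). Only the Markov property at deterministic times is used: the argument
runs on skeletons `X (j h)` and passes to the limit along dyadic meshes by right-continuity. A path
cannot change sign without visiting `0`, because a sign change within time `h` has probability
`O(h²)` (`measureReal_noVisit_mul_neg`). Hence the paths from `-k` contribute nothing when `k` and
`n` have the same sign, which is the avoiding probability.

Summed over `n`, the avoiding probabilities telescope to `survival`. Its derivative is minus the
passage density, and it vanishes at infinity because `exp (-x) * I_n(x)` does, so passage is almost
surely finite. The currents follow from Chapman–Kolmogorov by dominated convergence, using a bound
`p_{m,0}(τ) = O(τ)` uniform in `m ≠ 0`. -/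

/-! ### Modified Bessel functions of integer order -/

/-- The `m`-th term of the power series of `I_N(2 y)`. -/
noncomputable def besselTerm (N m : ℕ) (y : ℝ) : ℝ :=
  y ^ (2 * m + N) / ((m.factorial : ℝ) * ((m + N).factorial : ℝ))

theorem besselI_eq_tsum (n : ℤ) (x : ℝ) :
    besselI n x = ∑' m, besselTerm n.natAbs m (x / 2) := rfl

theorem besselTerm_nonneg (N m : ℕ) {y : ℝ} (hy : 0 ≤ y) : 0 ≤ besselTerm N m y := by
  unfold besselTerm; positivity

theorem abs_besselTerm_eq (N m : ℕ) (y : ℝ) : |besselTerm N m y| = besselTerm N m |y| := by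
  unfold besselTerm
  rw [abs_div, abs_pow, abs_of_nonneg (by positivity : (0 : ℝ) ≤ m.factorial * (m + N).factorial)]

theorem besselTerm_mono (N m : ℕ) {y z : ℝ} (hy : 0 ≤ y) (h : y ≤ z) :
    besselTerm N m y ≤ besselTerm N m z := by
  unfold besselTerm; gcongr

theorem besselTerm_le (N m : ℕ) {y : ℝ} (hy : 0 ≤ y) :
    besselTerm N m y ≤ y ^ N / N.factorial * ((y ^ 2) ^ m / m.factorial) := by
  have h : ((N.factorial : ℕ) : ℝ) ≤ (m + N).factorial := by
    exact_mod_cast Nat.factorial_le (Nat.le_add_left N m)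
  unfold besselTerm
  rw [div_mul_div_comm, pow_add, pow_mul, mul_comm (y ^ N), mul_comm (N.factorial : ℝ)]
  gcongr

theorem summable_besselTerm (N : ℕ) (y : ℝ) : Summable fun m => besselTerm N m y := by
  refine Summable.of_abs ?_
  simp_rw [abs_besselTerm_eq]
  exact Summable.of_nonneg_of_le (fun m => besselTerm_nonneg N m (abs_nonneg y))
    (fun m => besselTerm_le N m (abs_nonneg y)) ((Real.summable_pow_div_factorial _).mul_left _)

/-- The factor `|x/2|^|n| / |n|!` serves twice: it makes series over the order `n` converge, and it
gives the order of smallness in time of a displacement by `n`. -/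
theorem abs_besselI_le (n : ℤ) (x : ℝ) :
    |besselI n x| ≤ |x / 2| ^ n.natAbs / n.natAbs.factorial * Real.exp (|x / 2| ^ 2) := by
  have hs := (Real.summable_pow_div_factorial (|x / 2| ^ 2)).mul_left
    (|x / 2| ^ n.natAbs / n.natAbs.factorial)
  have h := tsum_of_norm_bounded hs.hasSum (f := fun m => besselTerm n.natAbs m (x / 2))
    (fun m => by
      rw [Real.norm_eq_abs, abs_besselTerm_eq]
      exact besselTerm_le _ m (abs_nonneg _))
  rw [tsum_mul_left] at h
  rw [besselI_eq_tsum, Real.exp_eq_exp_ℝ, NormedSpace.exp_eq_tsum_div]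
  exact h

theorem besselI_nonneg (n : ℤ) {x : ℝ} (hx : 0 ≤ x) : 0 ≤ besselI n x :=
  tsum_nonneg fun m => besselTerm_nonneg _ m (by positivity)

theorem besselI_le (n : ℤ) {x : ℝ} (hx : 0 ≤ x) :
    besselI n x ≤ (x / 2) ^ n.natAbs / n.natAbs.factorial * Real.exp ((x / 2) ^ 2) := by
  have := (le_abs_self _).trans (abs_besselI_le n x)
  rwa [abs_of_nonneg (by positivity : (0 : ℝ) ≤ x / 2)] at this

theorem besselI_neg (n : ℤ) (x : ℝ) : besselI (-n) x = besselI n x := by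
  simp [besselI]

theorem besselI_sub_comm (m n : ℤ) (x : ℝ) : besselI (m - n) x = besselI (n - m) x := by
  rw [← besselI_neg, neg_sub]

theorem besselI_apply_zero (n : ℤ) : besselI n 0 = if n = 0 then 1 else 0 := by
  rw [besselI_eq_tsum, tsum_eq_single 0]
  · by_cases h : n = 0 <;> simp [besselTerm, h]
  · intro m hm
    simp [besselTerm, hm]

theorem hasDerivAt_besselTerm_zero_succ (m : ℕ) (y : ℝ) :
    HasDerivAt (besselTerm 0 (m + 1)) (2 * besselTerm 1 m y) y := by
  unfold besselTerm
  have h := (hasDerivAt_pow (2 * (m + 1) + 0) y).div_const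
    (((m + 1).factorial : ℝ) * ((m + 1 + 0).factorial : ℝ))
  refine h.congr_deriv ?_
  rw [show 2 * (m + 1) + 0 - 1 = 2 * m + 1 by omega]
  simp only [Nat.factorial_succ, add_zero]
  push_cast
  field_simp

theorem hasDerivAt_besselTerm_succ_zero (N : ℕ) (y : ℝ) :
    HasDerivAt (besselTerm (N + 1) 0) (besselTerm N 0 y) y := by
  unfold besselTerm
  have h := (hasDerivAt_pow (2 * 0 + (N + 1)) y).div_const
    (((0 : ℕ).factorial : ℝ) * ((0 + (N + 1)).factorial : ℝ))
  refine h.congr_deriv ?_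
  rw [show 2 * 0 + (N + 1) - 1 = 2 * 0 + N by omega]
  simp only [zero_add, Nat.factorial_succ]
  push_cast
  field_simp
  ring

/-- The exponent splits as `(m + N + 2) + (m + 1)`. The first summand cancels the top factor of the
second factorial and lowers the order; the second cancels that of the first factorial and raises the
order. -/
theorem hasDerivAt_besselTerm_succ_succ (N m : ℕ) (y : ℝ) :
    HasDerivAt (besselTerm (N + 1) (m + 1))
      (besselTerm N (m + 1) y + besselTerm (N + 2) m y) y := by
  unfold besselTerm
  have h := (hasDerivAt_pow (2 * (m + 1) + (N + 1)) y).div_const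
    (((m + 1).factorial : ℝ) * ((m + 1 + (N + 1)).factorial : ℝ))
  refine h.congr_deriv ?_
  rw [show 2 * (m + 1) + (N + 1) - 1 = 2 * m + N + 2 by omega,
    show m + 1 + (N + 1) = (m + N + 1) + 1 by omega, show m + 1 + N = m + N + 1 by omega,
    show m + (N + 2) = (m + N + 1) + 1 by omega, show 2 * (m + 1) + N = 2 * m + N + 2 by omega,
    show 2 * m + (N + 2) = 2 * m + N + 2 by omega]
  simp only [Nat.factorial_succ]
  push_cast
  field_simp
  ring

theorem hasDerivAt_tsum_besselTerm_zero (y : ℝ) :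
    HasDerivAt (fun y => ∑' m, besselTerm 0 m y) (2 * ∑' m, besselTerm 1 m y) y := by
  have hsplit : (fun y => ∑' m, besselTerm 0 m y)
      = fun y => 1 + ∑' m, besselTerm 0 (m + 1) y := by
    funext z
    rw [(summable_besselTerm 0 z).tsum_eq_zero_add]
    simp [besselTerm]
  rw [hsplit, ← tsum_mul_left]
  refine HasDerivAt.const_add _ ?_
  refine hasDerivAt_tsum_of_isPreconnected
    (u := fun m => 2 * besselTerm 1 m (|y| + 1)) (t := Metric.ball 0 (|y| + 1)) (y₀ := y)
    ((summable_besselTerm 1 _).mul_left 2) Metric.isOpen_ball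
    (convex_ball _ _).isPreconnected (fun m z _ => hasDerivAt_besselTerm_zero_succ m z)
    ?_ (by simp) ((summable_nat_add_iff 1).2 (summable_besselTerm 0 y)) (by simp)
  intro m z hz
  rw [Real.norm_eq_abs, abs_mul, abs_besselTerm_eq, abs_two]
  rw [mem_ball_zero_iff, Real.norm_eq_abs] at hz
  have := besselTerm_mono 1 m (abs_nonneg z) hz.le
  linarith

theorem hasDerivAt_tsum_besselTerm_succ (N : ℕ) (y : ℝ) :
    HasDerivAt (fun y => ∑' m, besselTerm (N + 1) m y)
      (∑' m, besselTerm N m y + ∑' m, besselTerm (N + 2) m y) y := by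
  have hsplit : (fun y => ∑' m, besselTerm (N + 1) m y)
      = fun y => besselTerm (N + 1) 0 y + ∑' m, besselTerm (N + 1) (m + 1) y := by
    funext z
    rw [(summable_besselTerm (N + 1) z).tsum_eq_zero_add]
  have hs1 : ∀ z, Summable fun m => besselTerm N (m + 1) z := fun z =>
    (summable_nat_add_iff 1).2 (summable_besselTerm N z)
  rw [hsplit, (summable_besselTerm N y).tsum_eq_zero_add, add_assoc,
    ← (hs1 y).tsum_add (summable_besselTerm (N + 2) y)]
  refine HasDerivAt.add (hasDerivAt_besselTerm_succ_zero N y) ?_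
  refine hasDerivAt_tsum_of_isPreconnected
    (u := fun m => besselTerm N (m + 1) (|y| + 1) + besselTerm (N + 2) m (|y| + 1))
    (t := Metric.ball 0 (|y| + 1)) (y₀ := y)
    ((hs1 _).add (summable_besselTerm (N + 2) _)) Metric.isOpen_ball
    (convex_ball _ _).isPreconnected (fun m z _ => hasDerivAt_besselTerm_succ_succ N m z)
    ?_ (by simp) ((summable_nat_add_iff 1).2 (summable_besselTerm (N + 1) y)) (by simp)
  intro m z hz
  rw [mem_ball_zero_iff, Real.norm_eq_abs] at hz
  refine (abs_add_le _ _).trans ?_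
  rw [abs_besselTerm_eq, abs_besselTerm_eq]
  exact add_le_add (besselTerm_mono _ _ (abs_nonneg z) hz.le)
    (besselTerm_mono _ _ (abs_nonneg z) hz.le)

/-- The derivative recurrence `2 I_n' = I_{n-1} + I_{n+1}`. -/
theorem hasDerivAt_besselI (n : ℤ) (x : ℝ) :
    HasDerivAt (besselI n) ((besselI (n - 1) x + besselI (n + 1) x) / 2) x := by
  have hhalf : HasDerivAt (fun x : ℝ => x / 2) (1 / 2) x := (hasDerivAt_id x).div_const 2
  have key : ∀ N : ℕ, HasDerivAt (besselI N) ((besselI (N - 1) x + besselI (N + 1) x) / 2) x := by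
    rintro (_ | N)
    · have h := (hasDerivAt_tsum_besselTerm_zero (x / 2)).comp x hhalf
      refine h.congr_deriv ?_
      simp only [besselI_eq_tsum]
      norm_num
      ring
    · have h := (hasDerivAt_tsum_besselTerm_succ N (x / 2)).comp x hhalf
      refine h.congr_deriv ?_
      have h1 : ((N + 1 : ℕ) : ℤ) - 1 = (N : ℤ) := by push_cast; ring
      have h2 : ((N + 1 : ℕ) : ℤ) + 1 = ((N + 2 : ℕ) : ℤ) := by push_cast; ring
      rw [h1, h2]
      simp only [besselI_eq_tsum, Int.natAbs_natCast]
      ring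
  obtain ⟨N, rfl | rfl⟩ := n.eq_nat_or_neg
  · exact key N
  · have : besselI (-(N : ℤ)) = besselI N := funext fun x => besselI_neg _ x
    rw [this]
    refine (key N).congr_deriv ?_
    rw [← besselI_neg (-(N : ℤ) - 1), ← besselI_neg (-(N : ℤ) + 1)]
    ring_nf

theorem continuous_besselI (n : ℤ) : Continuous (besselI n) :=
  continuous_iff_continuousAt.2 fun x => (hasDerivAt_besselI n x).continuousAt

theorem summable_pow_natAbs_div_factorial (z : ℝ) :
    Summable fun n : ℤ => z ^ n.natAbs / n.natAbs.factorial := by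
  refine Summable.of_nat_of_neg ?_ ?_ <;> simpa using Real.summable_pow_div_factorial z

theorem summable_besselI (x : ℝ) : Summable fun n : ℤ => besselI n x :=
  Summable.of_norm_bounded ((summable_pow_natAbs_div_factorial |x / 2|).mul_right _)
    fun n => abs_besselI_le n x

/-- The symmetric partial sum `∑_{-k < m ≤ k} I_m(x)`. -/
noncomputable def besselSum (k : ℕ) (x : ℝ) : ℝ :=
  ∑ i ∈ Finset.range k, (besselI i x + besselI (i + 1) x)

theorem hasSum_sub_succ {a : ℕ → ℝ} (ha : Summable a) : HasSum (fun j => a j - a (j + 1)) (a 0) := by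
  have h := ha.hasSum.sub ((hasSum_nat_add_iff' 1).2 ha.hasSum)
  simpa using h

/-- Passing from `k` to `k + 1` changes the summand by two telescoping differences, whose sums are
`I_k` and `I_{k+1}`. -/
theorem hasSum_besselI_sub (k : ℕ) (x : ℝ) :
    HasSum (fun j : ℕ => besselI (k - (j + 1)) x - besselI (k + (j + 1)) x) (besselSum k x) := by
  induction k with
  | zero =>
    have : ∀ j : ℕ, besselI (((0 : ℕ) : ℤ) - (j + 1)) x - besselI (((0 : ℕ) : ℤ) + (j + 1)) x = 0 := by
      intro j
      rw [← besselI_neg (_ - _)]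
      simp
    simp_rw [this]
    simp [besselSum]
  | succ k ih =>
    have h1 := hasSum_sub_succ (a := fun j : ℕ => besselI (k - j) x)
      ((summable_besselI x).comp_injective (i := fun j : ℕ => (k : ℤ) - j)
        (fun a b h => by simpa using h))
    have h2 := hasSum_sub_succ (a := fun j : ℕ => besselI (k + 1 + j) x)
      ((summable_besselI x).comp_injective (i := fun j : ℕ => (k : ℤ) + 1 + j)
        (fun a b h => by simpa using h))
    have h := ih.add (h1.add h2)
    rw [besselSum, Finset.sum_range_succ, ← besselSum]
    convert h using 1
    · funext j
      push_cast
      ring_nf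
    · simp

/-- By the recurrence, the derivative is the mean of the sums over the window `-k < m ≤ k` shifted
by one either way. The downward shift trades `I_k` for `I_{-k}` and changes nothing; the upward
shift trades `I_{1-k} = I_{k-1}` for `I_{k+1}`. -/
theorem hasDerivAt_besselSum (k : ℕ) (x : ℝ) :
    HasDerivAt (besselSum k)
      (besselSum k x + (besselI (k + 1) x - besselI (k - 1) x) / 2) x := by
  have h := HasDerivAt.fun_sum (u := Finset.range k) (x := x)
    (A := fun (i : ℕ) x => besselI i x + besselI (i + 1) x)
    (fun i _ => (hasDerivAt_besselI i x).add (hasDerivAt_besselI (i + 1) x))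
  refine h.congr_deriv ?_
  clear h
  induction k with
  | zero => simp [besselSum, besselI_neg]
  | succ k ih =>
    rw [Finset.sum_range_succ, ih, besselSum, besselSum, Finset.sum_range_succ]
    push_cast
    ring_nf

theorem besselSum_apply_zero {k : ℕ} (hk : 0 < k) : besselSum k 0 = 1 := by
  rw [besselSum, Finset.sum_eq_single_of_mem 0 (by simpa using hk)]
  · simp [besselI_apply_zero]
  · intro i _ hi
    have : (i : ℤ) + 1 ≠ 0 := by omega
    simp [besselI_apply_zero, hi, this]

theorem besselSum_nonneg (k : ℕ) {x : ℝ} (hx : 0 ≤ x) : 0 ≤ besselSum k x :=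
  Finset.sum_nonneg fun _ _ => add_nonneg (besselI_nonneg _ hx) (besselI_nonneg _ hx)

/-! ### Decay of `exp (-x) * I_n(x)` -/

/-- A Stirling-free form of the decay of the central binomial probability like `n^(-1/2)`; the
induction rests on `(2n+1)(2n+3) ≤ (2n+2)²`. -/
theorem centralBinom_sq_mul_le (n : ℕ) : n.centralBinom ^ 2 * (2 * n + 1) ≤ 16 ^ n := by
  induction n with
  | zero => simp
  | succ n ih =>
    have h := Nat.succ_mul_centralBinom_succ n
    have h1 : (n + 1) ^ 2 * ((n + 1).centralBinom ^ 2 * (2 * (n + 1) + 1))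
        = 4 * (2 * n + 1) * (2 * n + 3) * (n.centralBinom ^ 2 * (2 * n + 1)) := by
      calc _ = ((n + 1) * (n + 1).centralBinom) ^ 2 * (2 * (n + 1) + 1) := by ring
        _ = _ := by rw [h]; ring
    have h2 : 4 * (2 * n + 1) * (2 * n + 3) ≤ (n + 1) ^ 2 * 16 := by nlinarith
    refine le_of_mul_le_mul_left ?_ (by positivity : 0 < (n + 1) ^ 2)
    calc _ = _ := h1
      _ ≤ (n + 1) ^ 2 * 16 * 16 ^ n := Nat.mul_le_mul h2 ih
      _ = _ := by ring

theorem choose_sq_mul_le (r n : ℕ) : n.choose r ^ 2 * (n + 1) ≤ 4 ^ n := by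
  have hmid := Nat.choose_le_middle r n
  refine (Nat.mul_le_mul_right _ (Nat.pow_le_pow_left hmid 2)).trans ?_
  obtain ⟨m, rfl | rfl⟩ := n.even_or_odd'
  · have := centralBinom_sq_mul_le m
    rw [Nat.centralBinom] at this
    rw [Nat.mul_div_cancel_left _ two_pos, pow_mul]
    simpa using this
  · have h := centralBinom_sq_mul_le (m + 1)
    have h2 : (m + 1).centralBinom = 2 * (2 * m + 1).choose m := by
      rw [Nat.centralBinom, show 2 * (m + 1) = 2 * m + 1 + 1 by ring, Nat.choose_succ_succ,
        Nat.choose_symm_half]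
      ring
    rw [h2] at h
    rw [show (2 * m + 1) / 2 = m by omega]
    have h3 : (16 : ℕ) ^ (m + 1) = 4 * 4 ^ (2 * m + 1) := by
      rw [pow_succ 4, pow_mul, pow_succ]; norm_num; ring
    rw [h3] at h
    nlinarith

/-- Averaging a null sequence over Poisson laws of growing mean gives a null function. -/
theorem tendsto_exp_neg_mul_tsum {b : ℕ → ℝ} (hb : Tendsto b atTop (𝓝 0)) :
    Tendsto (fun x : ℝ => Real.exp (-x) * ∑' n, x ^ n / n.factorial * b n) atTop (𝓝 0) := by
  obtain ⟨M, hM⟩ := hb.norm.bddAbove_range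
  have hM' : ∀ n, |b n| ≤ M := fun n => hM ⟨n, rfl⟩
  have hsum : ∀ x : ℝ, Summable fun n => x ^ n / n.factorial * b n := fun x => by
    refine Summable.of_norm_bounded (g := fun n => |x| ^ n / n.factorial * M)
      ((Real.summable_pow_div_factorial _).mul_right _) fun n => ?_
    simp only [norm_mul, norm_div, norm_pow, Real.norm_eq_abs, Nat.abs_cast]
    gcongr
    exact hM' n
  rw [Metric.tendsto_atTop]
  intro ε hε
  obtain ⟨J, hJ⟩ := (Metric.tendsto_atTop.1 hb) (ε / 2) (by positivity)
  -- The finitely many early terms are polynomial in `x` and lose against `exp (-x)`; the tail has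
  -- weights at most `ε / 2` and total Poisson mass at most `1`.
  have hhead : Tendsto (fun x : ℝ => Real.exp (-x) *
      ∑ n ∈ Finset.range J, x ^ n / n.factorial * b n) atTop (𝓝 0) := by
    simp_rw [Finset.mul_sum]
    rw [show (0 : ℝ) = ∑ n ∈ Finset.range J, 0 * (b n / n.factorial) by simp]
    refine tendsto_finsetSum _ fun n _ => ?_
    refine ((Real.tendsto_pow_mul_exp_neg_atTop_nhds_zero n).mul_const
      (b n / n.factorial)).congr fun x => ?_
    ring
  obtain ⟨A, hA⟩ := (Metric.tendsto_atTop.1 hhead) (ε / 2) (by positivity)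
  refine ⟨max A 0, fun x hx => ?_⟩
  have hx0 : 0 ≤ x := (le_max_right _ _).trans hx
  have h1 := hA x ((le_max_left _ _).trans hx)
  rw [dist_zero_right, Real.norm_eq_abs] at h1 ⊢
  rw [← (hsum x).sum_add_tsum_nat_add J, mul_add]
  have h2 : |∑' n, x ^ (n + J) / (n + J).factorial * b (n + J)| ≤ Real.exp x * (ε / 2) := by
    have hs := Real.summable_pow_div_factorial x
    have hle : ∑' n, x ^ (n + J) / (n + J).factorial ≤ Real.exp x := by
      rw [Real.exp_eq_exp_ℝ, NormedSpace.exp_eq_tsum_div]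
      change _ ≤ ∑' n : ℕ, x ^ n / (n.factorial : ℝ)
      rw [← hs.sum_add_tsum_nat_add J]
      exact le_add_of_nonneg_left (Finset.sum_nonneg fun n _ => by positivity)
    rw [← Real.norm_eq_abs]
    refine (tsum_of_norm_bounded ((((summable_nat_add_iff J).2 hs).mul_right (ε / 2)).hasSum)
      fun n => ?_).trans ?_
    · rw [norm_mul, norm_div, norm_pow, Real.norm_eq_abs, Real.norm_natCast,
        abs_of_nonneg hx0]
      gcongr
      have := hJ (n + J) (by omega)
      rw [dist_zero_right] at this
      exact this.le
    · rw [tsum_mul_right]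
      gcongr
  have h3 : |Real.exp (-x) * ∑' n, x ^ (n + J) / (n + J).factorial * b (n + J)| ≤ ε / 2 := by
    rw [abs_mul, abs_of_pos (Real.exp_pos _)]
    calc _ ≤ Real.exp (-x) * (Real.exp x * (ε / 2)) := by gcongr
      _ = ε / 2 := by rw [← mul_assoc, ← Real.exp_add]; simp
  exact (abs_add_le _ _).trans_lt (by linarith)

/-- With `N = 2m + |n|`, the `m`-th term of `I_n(x)` is `x^N / N!` times `N.choose m / 2^N`, the
probability that `N` fair steps end at `n`. This is at most `1 / √(N+1)`, so a Poisson average of a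
null sequence dominates. -/
theorem tendsto_exp_neg_mul_besselI (n : ℤ) :
    Tendsto (fun x : ℝ => Real.exp (-x) * besselI n x) atTop (𝓝 0) := by
  have hb : Tendsto (fun N : ℕ => √(1 / ((N : ℝ) + 1))) atTop (𝓝 0) := by
    simpa using (tendsto_one_div_add_atTop_nhds_zero_nat (𝕜 := ℝ)).sqrt
  have hsum : ∀ x : ℝ, Summable fun N : ℕ => x ^ N / N.factorial * √(1 / ((N : ℝ) + 1)) :=
    fun x => by
    refine Summable.of_norm_bounded (g := fun N => |x| ^ N / N.factorial * 1)
      ((Real.summable_pow_div_factorial _).mul_right _) fun n => ?_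
    simp only [norm_mul, norm_div, norm_pow, Real.norm_eq_abs, Nat.abs_cast,
      abs_of_nonneg (Real.sqrt_nonneg _)]
    gcongr
    refine Real.sqrt_le_one.2 ?_
    rw [div_le_one (by positivity)]
    have : (0 : ℝ) ≤ n := by positivity
    linarith
  refine squeeze_zero' ?_ ?_ (tendsto_exp_neg_mul_tsum hb)
  · filter_upwards [eventually_ge_atTop 0] with x hx
    exact mul_nonneg (Real.exp_pos _).le (besselI_nonneg n hx)
  · filter_upwards [eventually_ge_atTop 0] with x hx
    gcongr
    set k := n.natAbs
    have hinj : Function.Injective fun m : ℕ => 2 * m + k := fun a b h => by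
      simp only at h; omega
    refine le_trans ?_ (tsum_comp_le_tsum_of_inj (hsum x) (fun N => by positivity) hinj)
    refine (summable_besselTerm k (x / 2)).tsum_le_tsum (fun m => ?_)
      ((hsum x).comp_injective hinj)
    simp only [Function.comp]
    have hc := choose_sq_mul_le m (2 * m + k)
    have hf : ((2 * m + k).choose m : ℝ) * m.factorial * (m + k).factorial
        = (2 * m + k).factorial := by
      have := Nat.choose_mul_factorial_mul_factorial (n := 2 * m + k) (k := m) (by omega)
      rw [show 2 * m + k - m = m + k by omega] at this
      exact_mod_cast this
    have hc' : ((2 * m + k).choose m : ℝ) ^ 2 * (((2 * m + k : ℕ) : ℝ) + 1) ≤ 4 ^ (2 * m + k) := by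
      exact_mod_cast hc
    have hroot : ((2 * m + k).choose m : ℝ) / 2 ^ (2 * m + k)
        ≤ √(1 / (((2 * m + k : ℕ) : ℝ) + 1)) := by
      refine Real.le_sqrt_of_sq_le ?_
      rw [div_pow, ← pow_mul, mul_comm (2 * m + k) 2, pow_mul, div_le_div_iff₀ (by positivity) (by positivity)]
      norm_num
      push_cast at hc'
      exact hc'
    calc (x / 2) ^ (2 * m + k) / (m.factorial * (m + k).factorial)
        = x ^ (2 * m + k) / (2 * m + k).factorial
          * (((2 * m + k).choose m : ℝ) / 2 ^ (2 * m + k)) := by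
          rw [← hf, div_pow]
          have : ((2 * m + k).choose m : ℝ) ≠ 0 := by
            exact_mod_cast (Nat.choose_pos (by omega)).ne'
          field_simp
      _ ≤ _ := by gcongr

theorem tendsto_exp_neg_mul_besselSum (k : ℕ) :
    Tendsto (fun x : ℝ => Real.exp (-x) * besselSum k x) atTop (𝓝 0) := by
  simp_rw [besselSum, Finset.mul_sum, mul_add]
  rw [show (0 : ℝ) = ∑ i ∈ Finset.range k, (0 + 0) by simp]
  exact tendsto_finsetSum _ fun i _ =>
    (tendsto_exp_neg_mul_besselI i).add (tendsto_exp_neg_mul_besselI (i + 1))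

/-! ### Transition probabilities of a Markov chain with generator -/

theorem hasSum_measureReal_inter_eq {Ω : Type*} [MeasurableSpace Ω] (μ : Measure Ω)
    [IsFiniteMeasure μ] {f : Ω → ℤ} (hf : Measurable f) {B : Set Ω} (hB : MeasurableSet B) :
    HasSum (fun m : ℤ => μ.real (B ∩ {ω | f ω = m})) (μ.real B) := by
  have hU : B = ⋃ m : ℤ, B ∩ {ω | f ω = m} := by
    ext ω; simp
  have h : μ B = ∑' m : ℤ, μ (B ∩ {ω | f ω = m}) := by
    conv_lhs => rw [hU]
    refine measure_iUnion (fun i j hij => ?_) fun m => hB.inter (hf (measurableSet_singleton m))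
    refine Set.disjoint_left.2 fun ω h1 h2 => hij ?_
    exact h1.2.symm.trans h2.2
  have hne : ∑' m : ℤ, μ (B ∩ {ω | f ω = m}) ≠ ∞ := h ▸ measure_ne_top μ B
  have := ENNReal.hasSum_toReal hne
  rwa [← ENNReal.tsum_toReal_eq (fun m => measure_ne_top μ _), ← h] at this

section Chain

variable {Ω : Type*} [MeasurableSpace Ω] {X : ℝ≥0 → Ω → ℤ} {P : ℤ → Measure Ω}
  {q : ℤ → ℤ → ℝ}

theorem transProb_nonneg (k n : ℤ) (t : ℝ≥0) : 0 ≤ transProb X P k n t := measureReal_nonneg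

namespace IsMarkovChainWithGenerator

theorem measurableSet_eq (hX : IsMarkovChainWithGenerator X P q) (t : ℝ≥0) (n : ℤ) :
    MeasurableSet {ω | X t ω = n} := hX.measurable t (measurableSet_singleton n)

theorem transProb_le_one (hX : IsMarkovChainWithGenerator X P q) (k n : ℤ) (t : ℝ≥0) :
    transProb X P k n t ≤ 1 :=
  have := hX.isProbability k
  measureReal_le_one

theorem transProb_zero (hX : IsMarkovChainWithGenerator X P q) (k n : ℤ) :
    transProb X P k n 0 = if n = k then 1 else 0 := by
  have := hX.isProbability k
  have h : (P k).real {ω | X 0 ω = n} = (P k).real {_ω | k = n} := by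
    refine measureReal_congr ?_
    filter_upwards [hX.start k] with ω hω
    change (X 0 ω = n) = (k = n)
    rw [hω]
  rw [transProb, h]
  by_cases hkn : n = k
  · simp [hkn]
  · simp [hkn, Ne.symm hkn]

theorem markov_real (hX : IsMarkovChainWithGenerator X P q) (k : ℤ) (s t : ℝ≥0) (m n : ℤ)
    {A : Set Ω} (hA : MeasurableSet[⨆ u : Set.Iic s, MeasurableSpace.comap (X u) ⊤] A) :
    (P k).real (A ∩ {ω | X s ω = m} ∩ {ω | X (s + t) ω = n})
      = (P k).real (A ∩ {ω | X s ω = m}) * transProb X P m n t := by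
  rw [measureReal_def, hX.markov k s t m n A hA, ENNReal.toReal_mul]
  rfl

theorem markov_real_univ (hX : IsMarkovChainWithGenerator X P q) (k : ℤ) (s t : ℝ≥0) (m n : ℤ) :
    (P k).real ({ω | X s ω = m} ∩ {ω | X (s + t) ω = n})
      = transProb X P k m s * transProb X P m n t := by
  simpa [transProb] using hX.markov_real k s t m n MeasurableSet.univ

theorem hasSum_transProb (hX : IsMarkovChainWithGenerator X P q) (k : ℤ) (t : ℝ≥0) :
    HasSum (fun n => transProb X P k n t) 1 := by
  have := hX.isProbability k
  simpa [transProb] using hasSum_measureReal_inter_eq (P k) (hX.measurable t) MeasurableSet.univ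

theorem chapmanKolmogorov (hX : IsMarkovChainWithGenerator X P q) (k n : ℤ) (s t : ℝ≥0) :
    HasSum (fun m => transProb X P k m s * transProb X P m n t) (transProb X P k n (s + t)) := by
  have := hX.isProbability k
  have h := hasSum_measureReal_inter_eq (P k) (hX.measurable s) (hX.measurableSet_eq (s + t) n)
  simp_rw [Set.inter_comm {ω | X (s + t) ω = n}, hX.markov_real_univ] at h
  exact h

theorem sum_le_transProb_add (hX : IsMarkovChainWithGenerator X P q) (k n : ℤ) (s t : ℝ≥0)
    (F : Finset ℤ) :
    ∑ m ∈ F, transProb X P k m s * transProb X P m n t ≤ transProb X P k n (s + t) :=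
  sum_le_hasSum F (fun _ _ => mul_nonneg (transProb_nonneg ..) (transProb_nonneg ..))
    (hX.chapmanKolmogorov k n s t)

/-- The left side is the Chapman–Kolmogorov sum over `m ∉ F`; bounding `p_{m,n}(t)` by `1` leaves
the mass outside `F` at time `s`. -/
theorem transProb_add_le (hX : IsMarkovChainWithGenerator X P q) (k n : ℤ) (s t : ℝ≥0)
    (F : Finset ℤ) :
    transProb X P k n (s + t) - ∑ m ∈ F, transProb X P k m s * transProb X P m n t
      ≤ 1 - ∑ m ∈ F, transProb X P k m s := by
  have h := sum_le_hasSum F (fun m _ => ?_)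
    ((hX.hasSum_transProb k s).sub (hX.chapmanKolmogorov k n s t))
  · rw [Finset.sum_sub_distrib] at h
    linarith
  · nlinarith [transProb_nonneg (X := X) (P := P) k m s, hX.transProb_le_one m n t]

/-- The bound does not involve `t`, so continuity at time `0` propagates to all times, from both
sides. -/
theorem abs_transProb_add_sub_le (hX : IsMarkovChainWithGenerator X P q) (k n : ℤ) (s t : ℝ≥0) :
    |transProb X P k n (s + t) - transProb X P k n t| ≤ 1 - transProb X P k k s := by
  have h1 := hX.sum_le_transProb_add k n s t {k}
  have h2 := hX.transProb_add_le k n s t {k}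
  have h3 := hX.transProb_le_one k k s
  have h4 := hX.transProb_le_one k n t
  have h5 := transProb_nonneg (X := X) (P := P) k n t
  simp only [Finset.sum_singleton] at h1 h2
  rw [abs_le]
  constructor <;> nlinarith

theorem continuousOn_transProb (hX : IsMarkovChainWithGenerator X P q) (k n : ℤ) :
    ContinuousOn (fun t : ℝ => transProb X P k n t.toNNReal) (Set.Ici 0) := by
  intro t ht
  have hkk : Tendsto (fun s : ℝ => 1 - transProb X P k k s.toNNReal) (𝓝[≥] 0) (𝓝 0) := by
    have h := (hX.generator k k).continuousWithinAt.const_sub 1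
    simpa [ContinuousWithinAt, hX.transProb_zero] using h
  have habs : Tendsto (fun s : ℝ => |s - t|) (𝓝[Set.Ici 0] t) (𝓝[≥] 0) := by
    refine tendsto_nhdsWithin_iff.2 ⟨?_, Eventually.of_forall fun s => Set.mem_Ici.2 (abs_nonneg _)⟩
    have : Continuous fun s : ℝ => |s - t| := by fun_prop
    simpa using (this.tendsto t).mono_left nhdsWithin_le_nhds
  rw [ContinuousWithinAt, tendsto_iff_dist_tendsto_zero]
  refine squeeze_zero' (Eventually.of_forall fun _ => dist_nonneg) ?_ (hkk.comp habs)
  filter_upwards [self_mem_nhdsWithin] with s hs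
  rw [Set.mem_Ici] at hs ht
  rw [Real.dist_eq, Function.comp]
  rcases le_total t s with h | h
  · have := hX.abs_transProb_add_sub_le k n (s - t).toNNReal t.toNNReal
    rwa [← Real.toNNReal_add (by linarith) ht, sub_add_cancel,
      ← abs_of_nonneg (by linarith : 0 ≤ s - t)] at this
  · have := hX.abs_transProb_add_sub_le k n (t - s).toNNReal s.toNNReal
    rw [← Real.toNNReal_add (by linarith) hs, sub_add_cancel,
      ← abs_of_nonneg (by linarith : 0 ≤ t - s)] at this
    rwa [abs_sub_comm, abs_sub_comm s t]

/-- The backward equation, for a state whose row of the rate matrix is conservative with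
finite support. -/
theorem hasDerivWithinAt_transProb (hX : IsMarkovChainWithGenerator X P q) (k n : ℤ)
    (F : Finset ℤ) (hkF : k ∈ F) (hF : ∑ m ∈ F, q k m = 0) {t : ℝ} (ht : 0 ≤ t) :
    HasDerivWithinAt (fun s : ℝ => transProb X P k n s.toNNReal)
      (∑ m ∈ F, q k m * transProb X P m n t.toNNReal) (Set.Ici t) t := by
  set S : ℝ → ℝ := fun h => ∑ m ∈ F, transProb X P k m h.toNNReal * transProb X P m n t.toNNReal
    with hS
  have hSd : HasDerivWithinAt S (∑ m ∈ F, q k m * transProb X P m n t.toNNReal) (Set.Ici 0) 0 :=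
    HasDerivWithinAt.fun_sum fun m _ => (hX.generator k m).mul_const _
  have hDd : HasDerivWithinAt (fun h : ℝ => 1 - ∑ m ∈ F, transProb X P k m h.toNNReal) 0
      (Set.Ici 0) 0 := by
    have := (HasDerivWithinAt.fun_sum (u := F) fun m _ => hX.generator k m).const_sub 1
    rwa [hF, neg_zero] at this
  -- The part of Chapman–Kolmogorov outside `F` lies between `0` and the mass outside `F`. That mass
  -- has derivative `0` because the rates in `F` sum to zero, so no limit is exchanged with an
  -- infinite sum.
  set E : ℝ → ℝ := fun h => transProb X P k n (h + t).toNNReal - S h with hE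
  have hEd : HasDerivWithinAt E 0 (Set.Ici 0) 0 := by
    rw [hasDerivWithinAt_iff_isLittleO] at hDd ⊢
    refine Asymptotics.IsBigO.trans_isLittleO (Asymptotics.IsBigO.of_bound 1 ?_) hDd
    filter_upwards [self_mem_nhdsWithin] with h hh
    have hD0 : 1 - ∑ m ∈ F, transProb X P k m (0 : ℝ).toNNReal = 0 := by
      simp [hX.transProb_zero, hkF]
    have hE0 : E 0 = 0 := by
      simp [hE, hS, hX.transProb_zero, hkF]
    simp only [hD0, hE0, smul_zero, sub_zero, one_mul]
    have h1 := hX.sum_le_transProb_add k n h.toNNReal t.toNNReal F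
    have h2 := hX.transProb_add_le k n h.toNNReal t.toNNReal F
    rw [← Real.toNNReal_add hh ht] at h1 h2
    rw [Real.norm_eq_abs, Real.norm_eq_abs, abs_of_nonneg (sub_nonneg.2 h1),
      abs_of_nonneg ((sub_nonneg.2 h1).trans h2)]
    exact h2
  have hsum : HasDerivWithinAt (fun h : ℝ => transProb X P k n (h + t).toNNReal)
      (∑ m ∈ F, q k m * transProb X P m n t.toNNReal) (Set.Ici 0) 0 := by
    have := hEd.add hSd
    rw [zero_add] at this
    refine this.congr (fun h _ => ?_) ?_ <;> simp [hE]
  have hshift : HasDerivWithinAt (fun s : ℝ => s - t) 1 (Set.Ici t) t :=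
    ((hasDerivAt_id t).sub_const t).hasDerivWithinAt
  have hc : HasDerivWithinAt (fun h : ℝ => transProb X P k n (h + t).toNNReal)
      (∑ m ∈ F, q k m * transProb X P m n t.toNNReal) (Set.Ici 0) (t - t) := by
    rwa [sub_self]
  have := HasDerivWithinAt.comp (h := fun s : ℝ => s - t) t hc hshift
    fun s hs => Set.mem_Ici.2 (sub_nonneg.2 hs)
  rw [mul_one] at this
  refine this.congr (fun s _ => ?_) ?_ <;> simp

end IsMarkovChainWithGenerator

end Chain

/-! ### The rate matrix and uniqueness for the backward equation -/

theorem bdJumpRate_eq (lam mu al : ℝ) (k n : ℤ) :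
    bdJumpRate lam mu al k n = (if n = k + 1 then lam else 0) + (if n = k - 1 then mu else 0)
      + (if n = 0 then al else 0) - (if n = k then lam + mu + al else 0) := by
  unfold bdJumpRate
  by_cases h : n = k
  · subst h
    have h1 : n ≠ n - 1 := by omega
    by_cases h0 : n = 0 <;> simp [h0, h1]
  · simp [h]

/-- Since every rate is a sum of indicators, coincidences among `k`, `k ± 1` and `0` need no case
split. At `k = 0` the two `al` terms cancel. -/
theorem sum_bdJumpRate_mul (lam mu al : ℝ) (k : ℤ) (f : ℤ → ℝ) :
    ∑ m ∈ ({k, k + 1, k - 1, 0} : Finset ℤ), bdJumpRate lam mu al k m * f m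
      = lam * f (k + 1) + mu * f (k - 1) + al * f 0 - (lam + mu + al) * f k := by
  simp_rw [bdJumpRate_eq, sub_mul, add_mul, Finset.sum_sub_distrib, Finset.sum_add_distrib,
    ite_mul, zero_mul]
  simp [Finset.sum_ite_eq']
  ring

/-- A bounded solution of the backward equation with zero initial value vanishes. -/
theorem eq_zero_of_backward_equation {lam mu al : ℝ} (hlam : 0 ≤ lam) (hmu : 0 ≤ mu)
    (hal : 0 ≤ al) {T M : ℝ} {u : ℤ → ℝ → ℝ} (hcont : ∀ k, ContinuousOn (u k) (Set.Icc 0 T))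
    (hderiv : ∀ k, ∀ t ∈ Set.Ico 0 T, HasDerivWithinAt (u k)
      (lam * u (k + 1) t + mu * u (k - 1) t + al * u 0 t - (lam + mu + al) * u k t)
      (Set.Ici t) t)
    (hbound : ∀ k, ∀ t ∈ Set.Icc 0 T, |u k t| ≤ M) (hzero : ∀ k, u k 0 = 0)
    (k : ℤ) {t : ℝ} (ht : t ∈ Set.Icc 0 T) : u k t = 0 := by
  set K := 2 * (lam + mu + al) with hK
  -- Picard iteration: `K` bounds the generator in the sup norm, so each integration of the bound
  -- gains a factor `K * t / (j + 1)`.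
  have key : ∀ j : ℕ, ∀ k, ∀ t ∈ Set.Icc 0 T, |u k t| ≤ M * ((K * t) ^ j / j.factorial) := by
    intro j
    induction j with
    | zero => simpa using hbound
    | succ j ih =>
      intro k
      refine image_norm_le_of_norm_deriv_right_le_deriv_boundary (hcont k) (hderiv k)
        (B' := fun t => K * (M * ((K * t) ^ j / j.factorial))) ?_ ?_ ?_
      · simp [hzero]
      · intro x
        have h := ((((hasDerivAt_id x).const_mul K).pow (j + 1)).div_const
          (((j + 1).factorial : ℕ) : ℝ)).const_mul M
        refine h.congr_deriv ?_
        rw [Nat.factorial_succ]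
        push_cast
        simp only [id]
        field_simp
      · intro x hx
        have hb := fun k => ih k x (Set.Ico_subset_Icc_self hx)
        set b := M * ((K * x) ^ j / j.factorial)
        rw [Real.norm_eq_abs]
        have e : K * b = lam * b + mu * b + al * b + (lam + mu + al) * b := by rw [hK]; ring
        rw [e]
        refine (abs_sub _ _).trans (add_le_add ((abs_add_le _ _).trans (add_le_add
          ((abs_add_le _ _).trans (add_le_add ?_ ?_)) ?_)) ?_) <;> rw [abs_mul]
        · rw [abs_of_nonneg hlam]; gcongr; exact hb _
        · rw [abs_of_nonneg hmu]; gcongr; exact hb _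
        · rw [abs_of_nonneg hal]; gcongr; exact hb _
        · rw [abs_of_nonneg (by positivity : 0 ≤ lam + mu + al)]; gcongr; exact hb _
  have hlim : Tendsto (fun j : ℕ => M * ((K * t) ^ j / j.factorial)) atTop (𝓝 0) := by
    simpa using (FloorSemiring.tendsto_pow_div_factorial_atTop (K * t)).const_mul M
  exact abs_nonpos_iff.1 (ge_of_tendsto' hlim fun j => key j k t ht)

/-! ### The explicit transition probabilities -/

/-- The factor `(lam / mu)^(m/2)` turns the symmetric Bessel recurrence into one with weights `lam`
and `mu`. -/
theorem mul_rpow_half_add_one {lam mu : ℝ} (hlam : 0 < lam) (hmu : 0 < mu) (m : ℤ) :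
    mu * (lam / mu) ^ (((m + 1 : ℤ) : ℝ) / 2) = √(lam * mu) * (lam / mu) ^ ((m : ℝ) / 2) := by
  have h : mu * √(lam / mu) = √(lam * mu) := by
    rw [← Real.sqrt_sq hmu.le, ← Real.sqrt_mul (by positivity), Real.sqrt_sq hmu.le]
    congr 1
    field_simp
  rw [show ((m + 1 : ℤ) : ℝ) / 2 = (m : ℝ) / 2 + 1 / 2 by push_cast; ring,
    Real.rpow_add (by positivity), ← Real.sqrt_eq_rpow, ← h]
  ring

theorem mul_rpow_half_sub_one {lam mu : ℝ} (hlam : 0 < lam) (hmu : 0 < mu) (m : ℤ) :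
    lam * (lam / mu) ^ (((m - 1 : ℤ) : ℝ) / 2) = √(lam * mu) * (lam / mu) ^ ((m : ℝ) / 2) := by
  rw [← mul_rpow_half_add_one hlam hmu,
    show ((m + 1 : ℤ) : ℝ) / 2 = ((m - 1 : ℤ) : ℝ) / 2 + 1 by push_cast; ring,
    Real.rpow_add_one (by positivity)]
  field_simp

/-- The probability that the skip-free walk with birth rate `lam` and death rate `mu`, killed at
rate `al`, is displaced by `m` at time `t`. -/
noncomputable def walkProb (lam mu al : ℝ) (m : ℤ) (t : ℝ) : ℝ :=
  (lam / mu) ^ ((m : ℝ) / 2) * besselI m (2 * √(lam * mu) * t) * Real.exp (-(lam + mu + al) * t)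

theorem hasDerivAt_walkProb {lam mu : ℝ} (hlam : 0 < lam) (hmu : 0 < mu) (al : ℝ) (m : ℤ) (t : ℝ) :
    HasDerivAt (walkProb lam mu al m) (lam * walkProb lam mu al (m - 1) t
      + mu * walkProb lam mu al (m + 1) t - (lam + mu + al) * walkProb lam mu al m t) t := by
  have h1 : HasDerivAt (fun t => besselI m (2 * √(lam * mu) * t))
      ((besselI (m - 1) (2 * √(lam * mu) * t) + besselI (m + 1) (2 * √(lam * mu) * t)) / 2
        * (2 * √(lam * mu))) t := by
    have := (hasDerivAt_besselI m (2 * √(lam * mu) * t)).comp t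
      ((hasDerivAt_id t).const_mul (2 * √(lam * mu)))
    rwa [mul_one] at this
  have h2 : HasDerivAt (fun t => Real.exp (-(lam + mu + al) * t))
      (Real.exp (-(lam + mu + al) * t) * (-(lam + mu + al))) t := by
    have := ((hasDerivAt_id t).const_mul (-(lam + mu + al))).exp
    rwa [mul_one] at this
  refine ((h1.const_mul ((lam / mu) ^ ((m : ℝ) / 2))).mul h2).congr_deriv ?_
  have e1 := mul_rpow_half_sub_one hlam hmu m
  have e2 := mul_rpow_half_add_one hlam hmu m
  simp only [walkProb]
  linear_combination (-besselI (m - 1) (2 * √(lam * mu) * t) * Real.exp (-(lam + mu + al) * t)) * e1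
    + (-besselI (m + 1) (2 * √(lam * mu) * t) * Real.exp (-(lam + mu + al) * t)) * e2

theorem continuous_walkProb {lam mu : ℝ} (hlam : 0 < lam) (hmu : 0 < mu) (al : ℝ) (m : ℤ) :
    Continuous (walkProb lam mu al m) :=
  continuous_iff_continuousAt.2 fun t => (hasDerivAt_walkProb hlam hmu al m t).continuousAt

theorem walkProb_zero (lam mu al : ℝ) (m : ℤ) :
    walkProb lam mu al m 0 = if m = 0 then 1 else 0 := by
  by_cases h : m = 0 <;> simp [walkProb, besselI_apply_zero, h]

theorem exists_abs_walkProb_le {lam mu al : ℝ} (hlam : 0 < lam) (hmu : 0 < mu) (hal : 0 ≤ al)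
    (T : ℝ) : ∃ M, ∀ m, ∀ t ∈ Set.Icc 0 T, |walkProb lam mu al m t| ≤ M := by
  -- `κ ^ |m|` dominates `(lam / mu)^(m/2)` for both signs of `m`; the factorial in the Bessel bound
  -- then absorbs this geometric growth, uniformly in `m`.
  set κ := Real.exp (|Real.log (lam / mu)| / 2)
  set s := √(lam * mu)
  refine ⟨Real.exp (κ * (s * T)) * Real.exp ((s * T) ^ 2), fun m t ht => ?_⟩
  have hs : 0 ≤ s := Real.sqrt_nonneg _
  have hκ : (lam / mu) ^ ((m : ℝ) / 2) ≤ κ ^ m.natAbs := by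
    rw [Real.rpow_def_of_pos (by positivity), ← Real.exp_nat_mul, Real.exp_le_exp,
      Nat.cast_natAbs, Int.cast_abs]
    calc Real.log (lam / mu) * (m / 2) ≤ |Real.log (lam / mu) * (m / 2)| := le_abs_self _
      _ = _ := by rw [abs_mul, abs_div, abs_two]; ring
  have hI := besselI_le m (x := 2 * s * t) (by have := ht.1; positivity)
  have h0 := ht.1
  have hst : s * t ≤ s * T := by gcongr; exact ht.2
  rw [show 2 * s * t / 2 = s * t by ring] at hI
  have hI0 := besselI_nonneg m (x := 2 * s * t) (by positivity)
  rw [walkProb, abs_of_nonneg (by positivity)]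
  have hexp : Real.exp (-(lam + mu + al) * t) ≤ 1 := by
    rw [Real.exp_le_one_iff]
    have : 0 ≤ (lam + mu + al) * t := by positivity
    linarith
  calc (lam / mu) ^ ((m : ℝ) / 2) * besselI m (2 * s * t) * Real.exp (-(lam + mu + al) * t)
      ≤ κ ^ m.natAbs * ((s * t) ^ m.natAbs / m.natAbs.factorial * Real.exp ((s * t) ^ 2)) * 1 := by
        gcongr
    _ = (κ * (s * t)) ^ m.natAbs / m.natAbs.factorial * Real.exp ((s * t) ^ 2) := by
        rw [mul_pow]; ring
    _ ≤ Real.exp (κ * (s * t)) * Real.exp ((s * t) ^ 2) := by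
        gcongr
        exact Real.pow_div_factorial_le_exp _ (by positivity) _
    _ ≤ _ := by gcongr

/-- The contribution of the jumps to `0` to the transition probability to `n`. -/
noncomputable def jumpProb (lam mu al : ℝ) (n : ℤ) (t : ℝ) : ℝ :=
  ∫ τ in (0 : ℝ)..t, al * walkProb lam mu al n τ

theorem hasDerivAt_jumpProb {lam mu : ℝ} (hlam : 0 < lam) (hmu : 0 < mu) (al : ℝ) (n : ℤ) (t : ℝ) :
    HasDerivAt (jumpProb lam mu al n) (al * walkProb lam mu al n t) t :=
  ((continuous_walkProb hlam hmu al n).const_mul al).integral_hasStrictDerivAt 0 t |>.hasDerivAt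

/-- Inserted in the backward equation, `jumpProb` cancels since it does not depend on the start `k`.
What remains of the term with rate `al` is `al * walkProb lam mu al n`, the derivative of
`jumpProb`. -/
theorem IsMarkovChainWithGenerator.transProb_eq {Ω : Type*} [MeasurableSpace Ω]
    {X : ℝ≥0 → Ω → ℤ} {P : ℤ → Measure Ω} {lam mu al : ℝ} (hlam : 0 < lam) (hmu : 0 < mu)
    (hal : 0 ≤ al) (hX : IsMarkovChainWithGenerator X P (bdJumpRate lam mu al))
    (k n : ℤ) (t : ℝ≥0) :
    transProb X P k n t = walkProb lam mu al (n - k) t + jumpProb lam mu al n t := by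
  obtain ⟨M, hM⟩ := exists_abs_walkProb_le hlam hmu hal (t : ℝ)
  have hJ := hasDerivAt_jumpProb hlam hmu al n
  have hJc : Continuous (jumpProb lam mu al n) :=
    continuous_iff_continuousAt.2 fun t => (hJ t).continuousAt
  obtain ⟨M', hM'⟩ := (isCompact_Icc (a := (0 : ℝ)) (b := t)).exists_bound_of_continuousOn
    hJc.continuousOn
  have h := eq_zero_of_backward_equation hlam.le hmu.le hal (T := t) (M := 1 + (M + M'))
    (u := fun k s => transProb X P k n s.toNNReal
      - (walkProb lam mu al (n - k) s + jumpProb lam mu al n s)) ?_ ?_ ?_ ?_ k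
      (t := t) ⟨t.2, le_rfl⟩
  · simpa [sub_eq_zero] using h
  · intro k
    exact ((hX.continuousOn_transProb k n).mono fun s hs => hs.1).sub
      ((continuous_walkProb hlam hmu al _).add hJc).continuousOn
  · intro k s hs
    have hF : ∑ m ∈ ({k, k + 1, k - 1, 0} : Finset ℤ), bdJumpRate lam mu al k m = 0 := by
      have := sum_bdJumpRate_mul lam mu al k fun _ => 1
      simp only [mul_one] at this
      rw [this]; ring
    have h1 := hX.hasDerivWithinAt_transProb k n {k, k + 1, k - 1, 0} (by simp) hF hs.1
    rw [sum_bdJumpRate_mul lam mu al k fun m => transProb X P m n s.toNNReal] at h1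
    refine (h1.sub ((hasDerivAt_walkProb hlam hmu al (n - k) s).add
      (hJ s)).hasDerivWithinAt).congr_deriv ?_
    rw [show n - (k + 1) = n - k - 1 by ring, show n - (k - 1) = n - k + 1 by ring, sub_zero]
    ring
  · intro k s hs
    refine (abs_sub _ _).trans (add_le_add ?_ ((abs_add_le _ _).trans
      (add_le_add (hM _ s hs) (hM' s hs))))
    rw [abs_of_nonneg (transProb_nonneg ..)]
    exact hX.transProb_le_one ..
  · intro k
    simp [hX.transProb_zero, walkProb_zero, jumpProb, sub_eq_zero]

section Skeleton

variable {Ω : Type*} {X : ℝ≥0 → Ω → ℤ}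

/-! ### Skeleton chains and the first visit to `0` -/

/-- The skeleton `X (j h)` is nonzero for all `j < N`. -/
def gridAvoid (X : ℝ≥0 → Ω → ℤ) (h : ℝ≥0) (N : ℕ) : Set Ω :=
  {ω | ∀ j < N, X (j * h) ω ≠ 0}

/-- The chain does not visit `0` up to time `t`. -/
def noVisit (X : ℝ≥0 → Ω → ℤ) (t : ℝ≥0) : Set Ω :=
  {ω | ∀ θ ≤ t, X θ ω ≠ 0}

theorem gridAvoid_succ (h : ℝ≥0) (N : ℕ) :
    gridAvoid X h (N + 1) = gridAvoid X h N \ {ω | X (N * h) ω = 0} := by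
  ext ω
  refine ⟨fun hω => ⟨fun j hj => hω j (by omega), hω N (by omega)⟩, fun hω j hj => ?_⟩
  rcases Nat.lt_succ_iff_lt_or_eq.1 hj with hj | rfl
  exacts [hω.1 j hj, hω.2]

theorem noVisit_subset_gridAvoid {h t : ℝ≥0} {N : ℕ} (hN : N * h ≤ t) :
    noVisit X t ⊆ gridAvoid X h (N + 1) := fun ω hω j hj =>
  hω _ (le_trans (by gcongr; omega) hN)

theorem antitone_gridAvoid_dyadic (t : ℝ≥0) :
    Antitone fun M : ℕ => gridAvoid X (t / 2 ^ M) (2 ^ M + 1) := by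
  refine antitone_nat_of_succ_le fun M ω hω j hj => ?_
  have := hω (2 * j) (by rw [pow_succ]; omega)
  have e : ((2 * j : ℕ) : ℝ≥0) * (t / 2 ^ (M + 1)) = j * (t / 2 ^ M) := by
    push_cast
    rw [pow_succ]
    field_simp
  rwa [e] at this

theorem measurableSet_past_gridAvoid (h : ℝ≥0) (N : ℕ) :
    MeasurableSet[⨆ u : Set.Iic (N * h), MeasurableSpace.comap (X u) ⊤] (gridAvoid X h N) := by
  simp only [gridAvoid, Set.ofPred_forall]
  refine MeasurableSet.iInter fun j => MeasurableSet.iInter fun hj => ?_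
  have hle : (j : ℝ≥0) * h ≤ N * h := by gcongr
  exact le_iSup (fun u : Set.Iic ((N : ℝ≥0) * h) => MeasurableSpace.comap (X u) ⊤)
    ⟨j * h, hle⟩ _ ⟨{0}ᶜ, trivial, rfl⟩

end Skeleton

/-- A walk that avoids `0` and changes sign does so in one step. -/
theorem exists_mul_neg_of_sign_change {x : ℕ → ℤ} {N : ℕ} (hx : ∀ j ≤ N, x j ≠ 0)
    (h : x 0 * x N < 0) : ∃ i < N, x i * x (i + 1) < 0 := by
  by_contra! hcon
  have key : ∀ i ≤ N, 0 < x 0 * x i := by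
    intro i
    induction i with
    | zero => exact fun _ => mul_self_pos.2 (hx 0 N.zero_le)
    | succ i ih =>
      intro hi
      have h1 := ih (by omega)
      have h2 : 0 < x i * x (i + 1) := lt_of_le_of_ne (hcon i (by omega))
        (mul_ne_zero (hx i (by omega)) (hx (i + 1) hi)).symm
      have h3 : 0 < (x i * x i) * (x 0 * x (i + 1)) := by
        have := mul_pos h1 h2
        linarith [show x 0 * x i * (x i * x (i + 1)) = x i * x i * (x 0 * x (i + 1)) by ring]
      exact pos_of_mul_pos_right h3 (mul_self_nonneg _)
  exact absurd h (key N le_rfl).le.not_gt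

section Chain

variable {Ω : Type*} [MeasurableSpace Ω] {X : ℝ≥0 → Ω → ℤ} {P : ℤ → Measure Ω}
  {q : ℤ → ℤ → ℝ}

namespace IsMarkovChainWithGenerator

theorem exists_forall_eq (hX : IsMarkovChainWithGenerator X P q) (ω : Ω) (t : ℝ≥0) :
    ∃ δ > 0, ∀ u, t ≤ u → u < t + δ → X u ω = X t ω := by
  have h := hX.rightContinuous ω t
  rw [ContinuousWithinAt, nhds_discrete ℤ, tendsto_pure] at h
  obtain ⟨ε, hε, hε'⟩ := Metric.mem_nhdsWithin_iff.1 h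
  refine ⟨ε.toNNReal, by simpa using hε, fun u hu hu' => hε' ⟨?_, hu⟩⟩
  have h1 : (t : ℝ) ≤ u := by exact_mod_cast hu
  have h2 : (u : ℝ) < t + ε := by
    rw [← Real.coe_toNNReal ε hε.le]; exact_mod_cast hu'
  rw [Metric.mem_ball, NNReal.dist_eq, abs_of_nonneg (by linarith)]
  linarith

/-- By right-continuity on a discrete space, a visit to `0` at `θ` lasts for some time `δ`, and any
grid of mesh below `δ` detects it. -/
theorem iInter_gridAvoid (hX : IsMarkovChainWithGenerator X P q) (t : ℝ≥0) :
    ⋂ M : ℕ, gridAvoid X (t / 2 ^ M) (2 ^ M + 1) = noVisit X t := by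
  refine Set.Subset.antisymm (fun ω hω θ hθ h0 => ?_) (Set.subset_iInter fun M =>
    noVisit_subset_gridAvoid ?_)
  · rw [Set.mem_iInter] at hω
    -- The endpoint is a point of the coarsest grid; otherwise `t > 0` and the meshes are positive.
    rcases hθ.eq_or_lt with rfl | hlt
    · exact hω 0 1 (by norm_num) (by simpa using h0)
    obtain ⟨δ, hδ, hδ'⟩ := hX.exists_forall_eq ω θ
    have ht : 0 < t := (zero_le (a := θ)).trans_lt hlt
    obtain ⟨M, hM⟩ : ∃ M : ℕ, t / δ < 2 ^ M := pow_unbounded_of_one_lt _ one_lt_two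
    have hs : 0 < t / 2 ^ M := by positivity
    have hsδ : t / 2 ^ M < δ := by
      rw [div_lt_iff₀ hδ] at hM
      rwa [div_lt_iff₀ (by positivity), mul_comm]
    set i := ⌈θ / (t / 2 ^ M)⌉₊ with hi
    have hi1 : θ ≤ i * (t / 2 ^ M) := by
      rw [← div_le_iff₀ hs]; exact Nat.le_ceil _
    have hi2 : i * (t / 2 ^ M) < θ + δ := by
      have : (i : ℝ≥0) < θ / (t / 2 ^ M) + 1 := Nat.ceil_lt_add_one (by positivity)
      calc (i : ℝ≥0) * (t / 2 ^ M) < (θ / (t / 2 ^ M) + 1) * (t / 2 ^ M) := by gcongr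
        _ = θ + t / 2 ^ M := by rw [add_mul, div_mul_cancel₀ _ hs.ne', one_mul]
        _ < θ + δ := by gcongr
    have hi3 : i ≤ 2 ^ M := by
      rw [hi, Nat.ceil_le, div_le_iff₀ hs]
      push_cast
      rw [mul_div_cancel₀ _ (by positivity)]
      exact hθ
    exact hω M i (by omega) ((hδ' _ hi1 hi2).trans h0)
  · push_cast
    rw [mul_div_cancel₀ _ (by positivity)]

theorem measurableSet_gridAvoid (hX : IsMarkovChainWithGenerator X P q) (h : ℝ≥0) (N : ℕ) :
    MeasurableSet (gridAvoid X h N) := by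
  simp only [gridAvoid, Set.ofPred_forall]
  exact MeasurableSet.iInter fun j => MeasurableSet.iInter fun _ =>
    (hX.measurableSet_eq _ 0).compl

theorem measurableSet_noVisit (hX : IsMarkovChainWithGenerator X P q) (t : ℝ≥0) :
    MeasurableSet (noVisit X t) := by
  rw [← hX.iInter_gridAvoid]
  exact MeasurableSet.iInter fun M => hX.measurableSet_gridAvoid _ _

theorem markov_real_set (hX : IsMarkovChainWithGenerator X P q) (k : ℤ) (s t : ℝ≥0) (m : ℤ)
    (S : Set ℤ) :
    (P k).real ({ω | X s ω = m} ∩ {ω | X (s + t) ω ∈ S})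
      = transProb X P k m s * (P m).real {ω | X t ω ∈ S} := by
  classical
  have := hX.isProbability k
  have := hX.isProbability m
  have h1 := hasSum_measureReal_inter_eq (P k) (hX.measurable (s + t))
    ((hX.measurableSet_eq s m).inter (hX.measurable (s + t) (MeasurableSet.of_discrete (s := S))))
  have h2 := (hasSum_measureReal_inter_eq (P m) (hX.measurable t)
    (hX.measurable t (MeasurableSet.of_discrete (s := S)))).mul_left (transProb X P k m s)
  refine h1.unique (h2.congr_fun ?_)
  intro n
  by_cases hn : n ∈ S
  · have e1 : {ω | X s ω = m} ∩ (X (s + t) ⁻¹' S) ∩ {ω | X (s + t) ω = n}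
        = {ω | X s ω = m} ∩ {ω | X (s + t) ω = n} := by
      ext ω; simp only [Set.mem_inter_iff, Set.mem_preimage, Set.mem_ofPred_eq]
      constructor
      · tauto
      · rintro ⟨h1, rfl⟩; exact ⟨⟨h1, hn⟩, rfl⟩
    have e2 : (X t ⁻¹' S) ∩ {ω | X t ω = n} = {ω | X t ω = n} := by
      ext ω; simp only [Set.mem_inter_iff, Set.mem_preimage, Set.mem_ofPred_eq]
      constructor
      · tauto
      · rintro rfl; exact ⟨hn, rfl⟩
    rw [e1, e2, hX.markov_real_univ]
    rfl
  · have e1 : {ω | X s ω = m} ∩ (X (s + t) ⁻¹' S) ∩ {ω | X (s + t) ω = n} = ∅ := by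
      ext ω; simp only [Set.mem_inter_iff, Set.mem_preimage, Set.mem_ofPred_eq,
        Set.mem_empty_iff_false, iff_false]
      rintro ⟨⟨_, h2⟩, rfl⟩; exact hn h2
    have e2 : (X t ⁻¹' S) ∩ {ω | X t ω = n} = ∅ := by
      ext ω; simp only [Set.mem_inter_iff, Set.mem_preimage, Set.mem_ofPred_eq,
        Set.mem_empty_iff_false, iff_false]
      rintro ⟨h2, rfl⟩; exact hn h2
    rw [e1, e2]
    simp

/-- The probability that the skeleton visits `0` first at step `i`. -/
theorem measureReal_gridAvoid_inter_inter (hX : IsMarkovChainWithGenerator X P q) (k n : ℤ)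
    (h : ℝ≥0) {i N : ℕ} (hi : i ≤ N) :
    (P k).real (gridAvoid X h i ∩ {ω | X (i * h) ω = 0} ∩ {ω | X (N * h) ω = n})
      = (P k).real (gridAvoid X h i ∩ {ω | X (i * h) ω = 0})
        * transProb X P 0 n ((N - i : ℕ) * h) := by
  rw [← hX.markov_real k _ _ 0 n (measurableSet_past_gridAvoid h i), ← add_mul]
  norm_cast
  rw [Nat.add_sub_cancel' hi]

/-- First-visit decomposition along the skeleton. -/
theorem transProb_eq_gridAvoid_add_sum (hX : IsMarkovChainWithGenerator X P q) (k n : ℤ)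
    (h : ℝ≥0) (N : ℕ) {M : ℕ} (hM : M ≤ N + 1) :
    transProb X P k n (N * h) = (P k).real (gridAvoid X h M ∩ {ω | X (N * h) ω = n})
      + ∑ i ∈ Finset.range M, (P k).real (gridAvoid X h i ∩ {ω | X (i * h) ω = 0})
        * transProb X P 0 n ((N - i : ℕ) * h) := by
  have := hX.isProbability k
  induction M with
  | zero => simp [gridAvoid, transProb]
  | succ M ih =>
    rw [ih (by omega), Finset.sum_range_succ,
      ← hX.measureReal_gridAvoid_inter_inter k n h (show M ≤ N by omega), gridAvoid_succ,
      ← measureReal_inter_add_sdiff (s := gridAvoid X h M ∩ {ω | X (N * h) ω = n})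
        (hX.measurableSet_eq (M * h) 0), Set.inter_right_comm, Set.inter_sdiff_right_comm]
    ring

/-- A discrete renewal equation: with target `0`, the decomposition expresses the first-visit
probability at step `i` through `p_{k,0}(i h)` and earlier first-visit probabilities, with
coefficients `p_{0,0}` that do not depend on `k`. -/
theorem gridAvoid_firstVisit_symm (hX : IsMarkovChainWithGenerator X P q)
    {k k' : ℤ} (hsymm : ∀ t, transProb X P k 0 t = transProb X P k' 0 t) (h : ℝ≥0) (i : ℕ) :
    (P k).real (gridAvoid X h i ∩ {ω | X (i * h) ω = 0})
      = (P k').real (gridAvoid X h i ∩ {ω | X (i * h) ω = 0}) := by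
  induction i using Nat.strong_induction_on with
  | _ i ih =>
    have h1 := hX.transProb_eq_gridAvoid_add_sum k 0 h i (M := i) (by omega)
    have h2 := hX.transProb_eq_gridAvoid_add_sum k' 0 h i (M := i) (by omega)
    rw [hsymm, h2] at h1
    rw [Finset.sum_congr rfl fun j hj => by rw [← ih j (Finset.mem_range.1 hj)]] at h1
    linarith

/-- If the two starting points have the same probabilities of being in `0`, then the
difference of the transition probabilities is carried by the paths avoiding `0`. -/
theorem noVisit_sub_eq (hX : IsMarkovChainWithGenerator X P q)
    {k k' : ℤ} (hsymm : ∀ t, transProb X P k 0 t = transProb X P k' 0 t) (n : ℤ) (t : ℝ≥0) :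
    (P k).real (noVisit X t ∩ {ω | X t ω = n}) - (P k').real (noVisit X t ∩ {ω | X t ω = n})
      = transProb X P k n t - transProb X P k' n t := by
  have hgrid : ∀ (h : ℝ≥0) (N : ℕ),
      (P k).real (gridAvoid X h (N + 1) ∩ {ω | X (N * h) ω = n})
        - (P k').real (gridAvoid X h (N + 1) ∩ {ω | X (N * h) ω = n})
      = transProb X P k n (N * h) - transProb X P k' n (N * h) := by
    intro h N
    rw [hX.transProb_eq_gridAvoid_add_sum k n h N le_rfl,
      hX.transProb_eq_gridAvoid_add_sum k' n h N le_rfl,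
      Finset.sum_congr rfl fun j _ => by rw [hX.gridAvoid_firstVisit_symm hsymm]]
    ring
  have hlim : ∀ l : ℤ, Tendsto (fun M : ℕ =>
      (P l).real (gridAvoid X (t / 2 ^ M) (2 ^ M + 1) ∩ {ω | X t ω = n})) atTop
      (𝓝 ((P l).real (noVisit X t ∩ {ω | X t ω = n}))) := by
    intro l
    have := hX.isProbability l
    rw [← hX.iInter_gridAvoid, Set.iInter_inter]
    refine (ENNReal.tendsto_toReal (measure_ne_top _ _)).comp (tendsto_measure_iInter_atTop
      (fun M => ((hX.measurableSet_gridAvoid _ _).inter (hX.measurableSet_eq t n)).nullMeasurableSet)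
      (fun a b hab => Set.inter_subset_inter_left _ (antitone_gridAvoid_dyadic t hab))
      ⟨0, measure_ne_top _ _⟩)
  refine tendsto_nhds_unique ((hlim k).sub (hlim k')) (tendsto_const_nhds.congr fun M => ?_)
  have := hgrid (t / 2 ^ M) (2 ^ M)
  push_cast at this
  rw [mul_div_cancel₀ _ (by positivity)] at this
  exact this.symm

theorem measureReal_mul_neg_le (hX : IsMarkovChainWithGenerator X P q) {c : ℝ} (h : ℝ≥0)
    (hc : ∀ m, (P m).real {ω | m * X h ω < 0} ≤ c) (k : ℤ) (s : ℝ≥0) :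
    (P k).real {ω | X s ω * X (s + h) ω < 0} ≤ c := by
  have := hX.isProbability k
  have hmeas : MeasurableSet {ω | X s ω * X (s + h) ω < 0} :=
    measurableSet_lt ((hX.measurable s).mul (hX.measurable (s + h))) measurable_const
  have h1 := hasSum_measureReal_inter_eq (P k) (hX.measurable s) hmeas
  have h2 := (hX.hasSum_transProb k s).mul_right c
  rw [one_mul] at h2
  refine hasSum_le (fun m => ?_) h1 h2
  have e : {ω | X s ω * X (s + h) ω < 0} ∩ {ω | X s ω = m}
      = {ω | X s ω = m} ∩ {ω | X (s + h) ω ∈ {n : ℤ | m * n < 0}} := by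
    ext ω; simp only [Set.mem_inter_iff, Set.mem_ofPred_eq]
    constructor
    · rintro ⟨h1, rfl⟩; exact ⟨rfl, h1⟩
    · rintro ⟨rfl, h1⟩; exact ⟨h1, rfl⟩
  rw [e, hX.markov_real_set]
  exact mul_le_mul_of_nonneg_left (hc m) (transProb_nonneg ..)

/-- If sign changes in a time step `h` have probability `O(h²)`, then the chain visits `0`
whenever it changes sign. -/
theorem measureReal_noVisit_mul_neg (hX : IsMarkovChainWithGenerator X P q) {C δ : ℝ} (hδ : 0 < δ)
    (hC : ∀ (m : ℤ) (h : ℝ≥0), (h : ℝ) ≤ δ → (P m).real {ω | m * X h ω < 0} ≤ C * h ^ 2)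
    (k : ℤ) (t : ℝ≥0) :
    (P k).real (noVisit X t ∩ {ω | k * X t ω < 0}) = 0 := by
  have := hX.isProbability k
  refine le_antisymm ?_ measureReal_nonneg
  -- A union bound over `N + 1` steps of length `t / (N + 1)`, each of probability at most `C (t /
  -- (N + 1))²`, gives this total.
  have hlim : Tendsto (fun N : ℕ => C * t ^ 2 * (1 / ((N : ℝ) + 1))) atTop (𝓝 0) := by
    simpa using (tendsto_one_div_add_atTop_nhds_zero_nat (𝕜 := ℝ)).const_mul (C * t ^ 2)
  have hlim2 : Tendsto (fun N : ℕ => t * (1 / ((N : ℝ) + 1))) atTop (𝓝 0) := by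
    simpa using (tendsto_one_div_add_atTop_nhds_zero_nat (𝕜 := ℝ)).const_mul (t : ℝ)
  refine ge_of_tendsto hlim ?_
  filter_upwards [hlim2.eventually_le_const hδ] with N hN
  set h : ℝ≥0 := t / (N + 1) with hh
  have hhR : (h : ℝ) = t * (1 / ((N : ℝ) + 1)) := by
    rw [hh]; push_cast; ring
  have hNh : ((N + 1 : ℕ) : ℝ≥0) * h = t := by
    rw [hh]; push_cast; rw [mul_div_cancel₀ _ (by positivity)]
  have hstep : ∀ s, (P k).real {ω | X s ω * X (s + h) ω < 0} ≤ C * h ^ 2 :=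
    hX.measureReal_mul_neg_le h (fun m => hC m h (hhR ▸ hN)) k
  have hsub : (P k).real (noVisit X t ∩ {ω | k * X t ω < 0})
      ≤ (P k).real (⋃ i ∈ Finset.range (N + 1), {ω | X (i * h) ω * X (i * h + h) ω < 0}) := by
    refine ENNReal.toReal_mono (measure_ne_top _ _) (measure_mono_ae ?_)
    filter_upwards [hX.start k] with ω hω hmem
    obtain ⟨h1, h2⟩ := hmem
    obtain ⟨i, hi, hlt⟩ := exists_mul_neg_of_sign_change (x := fun i : ℕ => X (i * h) ω)
      (N := N + 1) (fun j hj => noVisit_subset_gridAvoid hNh.le h1 j (by omega)) (by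
        simp only [hNh, Nat.cast_zero, zero_mul, hω]; exact h2)
    refine Set.mem_biUnion (Finset.mem_coe.2 (Finset.mem_range.2 hi)) ?_
    have e : ((i + 1 : ℕ) : ℝ≥0) * h = i * h + h := by push_cast; ring
    simp only [e] at hlt
    exact hlt
  refine hsub.trans ((measureReal_biUnion_finset_le _ _).trans
    ((Finset.sum_le_sum fun (i : ℕ) _ => hstep (i * h)).trans ?_))
  rw [Finset.sum_const, Finset.card_range, nsmul_eq_mul, hhR]
  push_cast
  refine le_of_eq ?_
  field_simp

/-! ### The first-passage time -/

/-- The strict inequality matches the closed interval `[0, t]`: a path that is nonzero at `t` stays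
so until some `t + δ`, which pushes the infimum beyond `t`. -/
theorem setOf_lt_firstPassageTime (hX : IsMarkovChainWithGenerator X P q) (t : ℝ≥0) :
    {ω | (t : ℝ≥0∞) < firstPassageTime X 0 ω} = noVisit X t := by
  ext ω
  refine ⟨fun hω θ hθ h0 => ?_, fun hω => ?_⟩
  · have h1 : firstPassageTime X 0 ω ≤ θ := iInf₂_le θ h0
    exact absurd hω (h1.trans (by exact_mod_cast hθ)).not_gt
  · obtain ⟨δ, hδ, hδ'⟩ := hX.exists_forall_eq ω t
    have h1 : ((t + δ : ℝ≥0) : ℝ≥0∞) ≤ firstPassageTime X 0 ω := by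
      refine le_iInf₂ fun θ hθ => ?_
      by_contra! hlt
      have hlt' : θ < t + δ := by exact_mod_cast hlt
      rcases le_total θ t with h | h
      · exact hω θ h hθ
      · exact hω t le_rfl ((hδ' θ h hlt').symm.trans hθ)
    exact lt_of_lt_of_le (by exact_mod_cast lt_add_of_pos_right t hδ) h1

theorem measurable_firstPassageTime (hX : IsMarkovChainWithGenerator X P q) :
    Measurable (firstPassageTime X 0) := by
  refine measurable_of_Ioi fun a => ?_
  induction a with
  | top => simp
  | coe t =>
    have := hX.measurableSet_noVisit t
    rwa [← hX.setOf_lt_firstPassageTime] at this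

/-- A first-passage time has the density `-S'`, where `S` is its survival function. -/
theorem hasTimeDensity_of_survival (hX : IsMarkovChainWithGenerator X P q) {k : ℤ} {S g : ℝ → ℝ}
    (hS : ∀ t : ℝ≥0, (P k).real (noVisit X t) = S t) (hS0 : S 0 = 1)
    (hSd : ∀ t, HasDerivAt S (-g t) t) (hSlim : Tendsto S atTop (𝓝 0))
    (hg : Measurable g) (hg0 : ∀ t, 0 < t → 0 ≤ g t) :
    HasTimeDensity (P k) (firstPassageTime X 0) g := by
  have := hX.isProbability k
  refine ⟨hX.measurable_firstPassageTime.aemeasurable, hg.aemeasurable, hg0, ?_⟩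
  set ρ := ((volume.restrict (Set.Ioi (0 : ℝ))).withDensity
      (fun t => ENNReal.ofReal (g t))).map ENNReal.ofReal with hρ
  have hint : ∀ a, 0 ≤ a → ∫⁻ x in Set.Ioi a, ENNReal.ofReal (g x) = ENNReal.ofReal (S a) := by
    intro a ha
    have hd : ∀ x ∈ Set.Ici a, HasDerivAt (fun x => -S x) (g x) x := fun x _ =>
      (hSd x).fun_neg.congr_deriv (neg_neg _)
    have hpos : ∀ x ∈ Set.Ioi a, 0 ≤ g x := fun x hx => hg0 x (lt_of_le_of_lt ha hx)
    have hl : Tendsto (fun x => -S x) atTop (𝓝 0) := by simpa using hSlim.neg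
    rw [← ofReal_integral_eq_lintegral_ofReal (integrableOn_Ioi_deriv_of_nonneg' hd hpos hl)
      ((ae_restrict_iff' measurableSet_Ioi).2 (Eventually.of_forall hpos)),
      integral_Ioi_of_hasDerivAt_of_nonneg' hd hpos hl]
    simp
  have hρIoi : ∀ t : ℝ≥0, ρ (Set.Ioi (t : ℝ≥0∞)) = ENNReal.ofReal (S t) := by
    intro t
    have hm : MeasurableSet (ENNReal.ofReal ⁻¹' Set.Ioi (t : ℝ≥0∞)) :=
      ENNReal.measurable_ofReal measurableSet_Ioi
    have he : ENNReal.ofReal ⁻¹' Set.Ioi (t : ℝ≥0∞) = Set.Ioi (t : ℝ) := by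
      ext x
      rw [Set.mem_preimage, Set.mem_Ioi, Set.mem_Ioi, ← ENNReal.ofReal_coe_nnreal,
        ENNReal.ofReal_lt_ofReal_iff']
      exact ⟨fun h => h.1, fun h => ⟨h, t.2.trans_lt h⟩⟩
    rw [hρ, Measure.map_apply ENNReal.measurable_ofReal measurableSet_Ioi,
      withDensity_apply _ hm, he, Measure.restrict_restrict measurableSet_Ioi,
      Set.inter_eq_left.2 (Set.Ioi_subset_Ioi t.coe_nonneg), hint t t.2]
  -- Total mass `1` on finite times leaves none for `∞`, so equality of the laws includes almost
  -- sure finiteness.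
  have hρuniv : ρ Set.univ = 1 := by
    rw [hρ, Measure.map_apply ENNReal.measurable_ofReal MeasurableSet.univ, Set.preimage_univ,
      withDensity_apply _ MeasurableSet.univ, Measure.restrict_univ, hint 0 le_rfl, hS0]
    simp
  have hρp : IsProbabilityMeasure ρ := ⟨hρuniv⟩
  have hTp : IsProbabilityMeasure ((P k).map (firstPassageTime X 0)) :=
    Measure.isProbabilityMeasure_map hX.measurable_firstPassageTime.aemeasurable
  refine Measure.ext_of_Iic _ _ fun a => ?_
  rw [← Set.compl_Ioi, prob_compl_eq_one_sub measurableSet_Ioi,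
    prob_compl_eq_one_sub measurableSet_Ioi]
  congr 1
  induction a with
  | top => simp
  | coe t =>
    rw [hρIoi, ← hS, Measure.map_apply hX.measurable_firstPassageTime measurableSet_Ioi,
      ofReal_measureReal, ← hX.setOf_lt_firstPassageTime]
    rfl

end IsMarkovChainWithGenerator

end Chain

/-! ### The symmetric walk -/

theorem walkProb_self {lam : ℝ} (hlam : 0 < lam) (al : ℝ) (m : ℤ) (t : ℝ) :
    walkProb lam lam al m t = Real.exp (-(2 * lam + al) * t) * besselI m (2 * lam * t) := by
  rw [walkProb, div_self hlam.ne', Real.one_rpow, one_mul, Real.sqrt_mul_self hlam.le, mul_comm,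
    two_mul]

theorem walkProb_self_neg {lam : ℝ} (hlam : 0 < lam) (al : ℝ) (m : ℤ) :
    walkProb lam lam al (-m) = walkProb lam lam al m := by
  funext t
  rw [walkProb_self hlam, walkProb_self hlam, besselI_neg]

theorem walkProb_self_nonneg {lam : ℝ} (hlam : 0 < lam) (al : ℝ) (m : ℤ) {t : ℝ} (ht : 0 ≤ t) :
    0 ≤ walkProb lam lam al m t := by
  rw [walkProb_self hlam]
  exact mul_nonneg (Real.exp_pos _).le (besselI_nonneg _ (by positivity))

/-- The exponent `j` is the order in `t` wanted by the caller; the full factorial is kept so that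
the bound can still be summed over `m`. -/
theorem walkProb_self_le {lam al : ℝ} (hlam : 0 < lam) (hal : 0 ≤ al) {m : ℤ} {t : ℝ}
    (ht : 0 ≤ t) (ht1 : lam * t ≤ 1) {j : ℕ} (hj : j ≤ m.natAbs) :
    walkProb lam lam al m t ≤ (lam * t) ^ j / m.natAbs.factorial * Real.exp 1 := by
  have hy : 0 ≤ lam * t := by positivity
  have hI := besselI_le m (x := 2 * lam * t) (by positivity)
  have hI0 := besselI_nonneg m (x := 2 * lam * t) (by positivity)
  rw [show 2 * lam * t / 2 = lam * t by ring] at hI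
  have hexp : Real.exp (-(2 * lam + al) * t) ≤ 1 := by
    rw [Real.exp_le_one_iff]
    have : 0 ≤ (2 * lam + al) * t := by positivity
    linarith
  rw [walkProb_self hlam]
  calc _ ≤ besselI m (2 * lam * t) := mul_le_of_le_one_left hI0 hexp
    _ ≤ _ := hI
    _ ≤ _ := by
      gcongr ?_ / _ * Real.exp ?_
      · exact pow_le_pow_of_le_one hy ht1 hj
      · exact pow_le_one₀ hy ht1

theorem jumpProb_self_neg {lam : ℝ} (hlam : 0 < lam) (al : ℝ) (n : ℤ) (t : ℝ) :
    jumpProb lam lam al (-n) t = jumpProb lam lam al n t := by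
  rw [jumpProb, jumpProb, walkProb_self_neg hlam]

theorem jumpProb_self_le {lam al : ℝ} (hlam : 0 < lam) (hal : 0 ≤ al) {n : ℤ} {t : ℝ}
    (ht : 0 ≤ t) (ht1 : lam * t ≤ 1) {j : ℕ} (hj : j ≤ n.natAbs) :
    jumpProb lam lam al n t ≤ al * ((lam * t) ^ j / n.natAbs.factorial * Real.exp 1) * t := by
  have h := intervalIntegral.norm_integral_le_of_norm_le_const (a := 0) (b := t)
    (f := fun τ => al * walkProb lam lam al n τ)
    (C := al * ((lam * t) ^ j / n.natAbs.factorial * Real.exp 1)) fun τ hτ => ?_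
  · rw [sub_zero, abs_of_nonneg ht] at h
    exact (le_abs_self _).trans h
  · rw [Set.uIoc_of_le ht] at hτ
    have h0 := walkProb_self_nonneg hlam al n hτ.1.le
    have hle : lam * τ ≤ lam * t := by gcongr; exact hτ.2
    have hτ0 : 0 ≤ lam * τ := mul_nonneg hlam.le hτ.1.le
    rw [Real.norm_eq_abs, abs_of_nonneg (by positivity)]
    gcongr
    refine (walkProb_self_le hlam hal hτ.1.le (hle.trans ht1) hj).trans ?_
    gcongr

/-- The survival function `e^{-(2 lam + al) t} ∑_{-k < m ≤ k} I_m(2 lam t)` of the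
first-passage time from `± k` to `0`. -/
noncomputable def survival (lam al : ℝ) (k : ℕ) (t : ℝ) : ℝ :=
  Real.exp (-(2 * lam + al) * t) * besselSum k (2 * lam * t)

theorem passageDensity_eq (lam al : ℝ) (k : ℕ) (t : ℝ) :
    passageDensity lam al k t = Real.exp (-(2 * lam + al) * t) *
      (lam * (besselI (k - 1) (2 * lam * t) - besselI (k + 1) (2 * lam * t))
        + al * besselSum k (2 * lam * t)) := by
  rw [passageDensity, (hasSum_besselI_sub k _).tsum_eq]

/-- The summand `besselSum` of its own derivative cancels the decay at rate `2 * lam`, leaving the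
killing at rate `al` and the boundary terms. -/
theorem hasDerivAt_survival (lam al : ℝ) (k : ℕ) (t : ℝ) :
    HasDerivAt (survival lam al k) (-passageDensity lam al k t) t := by
  have h1 : HasDerivAt (fun t => Real.exp (-(2 * lam + al) * t))
      (Real.exp (-(2 * lam + al) * t) * (-(2 * lam + al))) t := by
    simpa using ((hasDerivAt_id t).const_mul (-(2 * lam + al))).exp
  have h2 := (hasDerivAt_besselSum k (2 * lam * t)).comp t
      ((hasDerivAt_id t).const_mul (2 * lam))
  refine (h1.mul h2).congr_deriv ?_
  rw [passageDensity_eq]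
  simp only [Function.comp]
  ring

theorem survival_zero (lam al : ℝ) {k : ℕ} (hk : 0 < k) : survival lam al k 0 = 1 := by
  simp [survival, besselSum_apply_zero hk]

/-- As `al = 0` is allowed, killing cannot be relied on; the decay comes from the Bessel functions,
that is, from recurrence of the symmetric walk. -/
theorem tendsto_survival {lam al : ℝ} (hlam : 0 < lam) (hal : 0 ≤ al) (k : ℕ) :
    Tendsto (survival lam al k) atTop (𝓝 0) := by
  have h2 : Tendsto (fun t : ℝ => 2 * lam * t) atTop atTop :=
    tendsto_id.const_mul_atTop (by positivity)
  refine squeeze_zero' ?_ ?_ ((tendsto_exp_neg_mul_besselSum k).comp h2)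
  · filter_upwards [eventually_ge_atTop 0] with t ht
    exact mul_nonneg (Real.exp_pos _).le (besselSum_nonneg _ (by positivity))
  · filter_upwards [eventually_ge_atTop 0] with t ht
    refine mul_le_mul_of_nonneg_right (Real.exp_le_exp.2 ?_) (besselSum_nonneg _ (by positivity))
    have : 0 ≤ al * t := by positivity
    linarith

theorem measurable_passageDensity (lam al : ℝ) (k : ℕ) : Measurable (passageDensity lam al k) := by
  have h : passageDensity lam al k = _ := funext (passageDensity_eq lam al k)
  have h1 := continuous_besselI (k - 1)
  have h2 := continuous_besselI (k + 1)
  have h3 : Continuous (besselSum k) :=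
    continuous_iff_continuousAt.2 fun x => (hasDerivAt_besselSum k x).continuousAt
  rw [h]
  exact Continuous.measurable (by fun_prop)

section Chain

variable {Ω : Type*} [MeasurableSpace Ω] {X : ℝ≥0 → Ω → ℤ} {P : ℤ → Measure Ω}

namespace IsMarkovChainWithGenerator

/-! ### Probability currents into `0` -/

section Currents

variable {q : ℤ → ℤ → ℝ}

theorem hasSum_current (hX : IsMarkovChainWithGenerator X P q) (k : ℤ) (t τ : ℝ≥0)
    {i : ℕ → ℤ} (hi : Function.Injective i) (S : Set ℤ) (hS : ∀ m, m ∈ S ↔ m ∈ Set.range i) :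
    HasSum (fun j : ℕ => transProb X P k (i j) t * transProb X P (i j) 0 τ)
      ((P k).real {ω | X (t + τ) ω = 0 ∧ X t ω ∈ S}) := by
  have := hX.isProbability k
  have h := hasSum_measureReal_inter_eq (P k) (hX.measurable t)
    ((hX.measurableSet_eq (t + τ) 0).inter
      (hX.measurable t (MeasurableSet.of_discrete (s := S))))
  rw [← hi.hasSum_iff] at h
  · refine h.congr_fun fun j => ?_
    rw [← hX.markov_real_univ]
    simp only [Function.comp]
    congr 1
    ext ω
    simp only [Set.mem_inter_iff, Set.mem_preimage, Set.mem_ofPred_eq]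
    constructor
    · rintro ⟨h1, h2⟩; exact ⟨⟨h2, (hS _).2 ⟨j, h1.symm⟩⟩, h1⟩
    · rintro ⟨⟨h1, _⟩, h3⟩; exact ⟨h3, h1⟩
  · intro m hm
    rw [← hS] at hm
    convert measureReal_empty (μ := P k) using 2
    ext ω
    simp only [Set.mem_inter_iff, Set.mem_preimage, Set.mem_ofPred_eq, Set.mem_empty_iff_false,
      iff_false]
    rintro ⟨⟨_, h2⟩, rfl⟩
    exact hm h2

theorem summable_transProb_comp (hX : IsMarkovChainWithGenerator X P q) (k : ℤ) (t : ℝ≥0)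
    {i : ℕ → ℤ} (hi : Function.Injective i) : Summable fun j => transProb X P k (i j) t :=
  (hX.hasSum_transProb k t).summable.comp_injective hi

/-- If `p_{m,0}(τ) = O(τ)` uniformly in `m ≠ 0`, the probability current into `0` out of a set
of nonzero states is given by the rates. -/
theorem tendsto_current (hX : IsMarkovChainWithGenerator X P q) {C δ : ℝ} (hδ : 0 < δ)
    (hC : ∀ (m : ℤ) (τ : ℝ≥0), m ≠ 0 → (τ : ℝ) ≤ δ → transProb X P m 0 τ ≤ C * τ)
    (k : ℤ) (t : ℝ≥0) {i : ℕ → ℤ} (hi : Function.Injective i) (hi0 : ∀ j, i j ≠ 0)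
    (S : Set ℤ) (hS : ∀ m, m ∈ S ↔ m ∈ Set.range i) :
    Tendsto (fun τ : ℝ≥0 => (P k).real {ω | X (t + τ) ω = 0 ∧ X t ω ∈ S} / (τ : ℝ))
      (𝓝[>] 0) (𝓝 (∑' j, transProb X P k (i j) t * q (i j) 0)) := by
  have hsum := (hX.summable_transProb_comp k t hi).mul_right C
  have hcoe : Tendsto (fun τ : ℝ≥0 => (τ : ℝ)) (𝓝[>] 0) (𝓝[>] 0) := by
    refine tendsto_nhdsWithin_iff.2 ⟨?_, ?_⟩
    · exact (NNReal.continuous_coe.tendsto 0).mono_left nhdsWithin_le_nhds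
    · filter_upwards [self_mem_nhdsWithin] with τ hτ
      exact NNReal.coe_pos.2 hτ
  -- The dominating series is `C * p_{k,i j}(t)`, summable because the transition probabilities are.
  have key := tendsto_tsum_of_dominated_convergence (𝓕 := 𝓝[>] (0 : ℝ≥0))
    (f := fun τ j => transProb X P k (i j) t * transProb X P (i j) 0 τ / (τ : ℝ))
    (g := fun j => transProb X P k (i j) t * q (i j) 0) hsum (fun j => ?_) ?_
  · refine key.congr fun τ => ?_
    rw [tsum_div_const, (hX.hasSum_current k t τ hi S hS).tsum_eq]
  · have hd := (hX.generator (i j) 0)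
    rw [hasDerivWithinAt_iff_tendsto_slope, Set.Ici_sdiff_left] at hd
    refine ((hd.comp hcoe).const_mul (transProb X P k (i j) t)).congr fun τ => ?_
    simp only [Function.comp, slope_def_field, Real.toNNReal_zero, hX.transProb_zero,
      if_neg (hi0 j).symm, Real.toNNReal_coe, sub_zero]
    ring
  · have h1 : ∀ᶠ τ : ℝ≥0 in 𝓝[>] 0, (τ : ℝ) ≤ δ :=
      (hcoe.mono_right nhdsWithin_le_nhds).eventually_le_const hδ
    filter_upwards [h1, self_mem_nhdsWithin] with τ hτ hτ0 j
    have hτ0' : (0 : ℝ) < τ := NNReal.coe_pos.2 hτ0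
    have hp := transProb_nonneg (X := X) (P := P) k (i j) t
    have hp' := transProb_nonneg (X := X) (P := P) (i j) 0 τ
    rw [Real.norm_eq_abs, abs_of_nonneg (by positivity), mul_div_assoc]
    gcongr
    rw [div_le_iff₀ hτ0']
    exact hC _ τ (hi0 j) hτ

end Currents

/-! ### The symmetric chain: reflection, sign changes and first passage -/

variable {lam al : ℝ}

theorem transProb_neg_zero (hlam : 0 < lam) (hal : 0 ≤ al)
    (hX : IsMarkovChainWithGenerator X P (bdJumpRate lam lam al)) (k : ℤ) (t : ℝ≥0) :
    transProb X P k 0 t = transProb X P (-k) 0 t := by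
  rw [hX.transProb_eq hlam hlam hal, hX.transProb_eq hlam hlam hal,
    ← walkProb_self_neg hlam, show -(0 - k) = 0 - -k by ring]

theorem transProb_sub_transProb_neg (hlam : 0 < lam) (hal : 0 ≤ al)
    (hX : IsMarkovChainWithGenerator X P (bdJumpRate lam lam al)) (k n : ℤ) (t : ℝ≥0) :
    transProb X P k n t - transProb X P (-k) n t = Real.exp (-(2 * lam + al) * t)
      * (besselI (n - k) (2 * lam * t) - besselI (n + k) (2 * lam * t)) := by
  rw [hX.transProb_eq hlam hlam hal, hX.transProb_eq hlam hlam hal, walkProb_self hlam,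
    walkProb_self hlam, sub_neg_eq_add]
  ring

theorem transProb_sub_transProb_right_neg (hlam : 0 < lam) (hal : 0 ≤ al)
    (hX : IsMarkovChainWithGenerator X P (bdJumpRate lam lam al)) (k n : ℤ) (t : ℝ≥0) :
    transProb X P k n t - transProb X P k (-n) t = Real.exp (-(2 * lam + al) * t)
      * (besselI (k - n) (2 * lam * t) - besselI (k + n) (2 * lam * t)) := by
  rw [hX.transProb_eq hlam hlam hal, hX.transProb_eq hlam hlam hal, jumpProb_self_neg hlam,
    walkProb_self hlam, walkProb_self hlam, besselI_sub_comm n k,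
    ← besselI_neg (-n - k), neg_sub, sub_neg_eq_add]
  ring

theorem transProb_self_zero_le (hlam : 0 < lam) (hal : 0 ≤ al)
    (hX : IsMarkovChainWithGenerator X P (bdJumpRate lam lam al)) {m : ℤ} (hm : m ≠ 0)
    {τ : ℝ≥0} (hτ : (τ : ℝ) ≤ 1 / lam) :
    transProb X P m 0 τ ≤ ((lam + al) * Real.exp 1) * τ := by
  have hy : lam * τ ≤ 1 := by rwa [le_div_iff₀ hlam, mul_comm] at hτ
  have h1 := walkProb_self_le (al := al) hlam hal (m := 0 - m) τ.coe_nonneg hy (j := 1) (by omega)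
  have h2 := jumpProb_self_le hlam hal (n := 0) τ.coe_nonneg hy (j := 0) (by omega)
  have hf : (lam * τ) ^ 1 / ((0 - m).natAbs.factorial : ℝ) ≤ lam * τ := by
    rw [pow_one]
    exact div_le_self (by positivity) (by exact_mod_cast Nat.one_le_iff_ne_zero.2 (Nat.factorial_ne_zero _))
  have h3 : (lam * τ) ^ 1 / ((0 - m).natAbs.factorial : ℝ) * Real.exp 1 ≤ lam * τ * Real.exp 1 := by
    gcongr
  rw [hX.transProb_eq hlam hlam hal]
  simp only [pow_zero, Int.natAbs_zero, Nat.factorial_zero, Nat.cast_one, div_one, one_mul] at h2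
  linarith

/-- For `m` and `n` of opposite signs `|n - m| = |n| + |m| ≥ 2`, so the walk term is `O(h²)`; the
jump term needs a jump and then `|n| ≥ 1` steps, again `O(h²)`. The factor `1 / |n|!` makes the sum
over `n` finite, uniformly in `m`. -/
theorem exists_measureReal_sign_change_le (hlam : 0 < lam) (hal : 0 ≤ al)
    (hX : IsMarkovChainWithGenerator X P (bdJumpRate lam lam al)) :
    ∃ C : ℝ, ∀ (m : ℤ) (h : ℝ≥0), (h : ℝ) ≤ 1 / lam →
      (P m).real {ω | m * X h ω < 0} ≤ C * h ^ 2 := by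
  have hs := summable_pow_natAbs_div_factorial 1
  set A := (lam ^ 2 + al * lam) * Real.exp 1
  refine ⟨(∑' n : ℤ, (1 : ℝ) ^ n.natAbs / n.natAbs.factorial) * A, fun m h hh => ?_⟩
  have := hX.isProbability m
  have hy : lam * h ≤ 1 := by rwa [le_div_iff₀ hlam, mul_comm] at hh
  have hmeas : MeasurableSet {ω | m * X h ω < 0} :=
    measurableSet_lt ((hX.measurable h).const_mul m) measurable_const
  rw [mul_assoc]
  refine hasSum_le (fun n => ?_) (hasSum_measureReal_inter_eq (P m) (hX.measurable h) hmeas)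
    (hs.hasSum.mul_right (A * h ^ 2))
  rw [one_pow]
  by_cases hn : m * n < 0
  · refine (measureReal_mono Set.inter_subset_right).trans ?_
    change transProb X P m n h ≤ _
    have habs : (n - m).natAbs = n.natAbs + m.natAbs := by
      rcases mul_neg_iff.1 hn with h | h <;> omega
    have hn0 : n ≠ 0 := by rintro rfl; simp at hn
    have hm0 : m ≠ 0 := by rintro rfl; simp at hn
    have h1 := walkProb_self_le (al := al) hlam hal (m := n - m) h.coe_nonneg hy (j := 2) (by omega)
    have h2 := jumpProb_self_le hlam hal (n := n) h.coe_nonneg hy (j := 1) (by omega)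
    have h3 : (lam * h) ^ 2 / ((n - m).natAbs.factorial : ℝ) * Real.exp 1
        ≤ (lam * h) ^ 2 / (n.natAbs.factorial : ℝ) * Real.exp 1 := by
      gcongr
      omega
    rw [hX.transProb_eq hlam hlam hal]
    refine (add_le_add (h1.trans h3) h2).trans (le_of_eq ?_)
    simp only [A]
    ring
  · have e : {ω | m * X h ω < 0} ∩ {ω | X h ω = n} = ∅ := by
      ext ω
      simp only [Set.mem_inter_iff, Set.mem_ofPred_eq, Set.mem_empty_iff_false, iff_false]
      rintro ⟨h1, rfl⟩
      exact hn h1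
    rw [e, measureReal_empty]
    positivity

theorem measureReal_noVisit_of_mul_neg (hlam : 0 < lam) (hal : 0 ≤ al)
    (hX : IsMarkovChainWithGenerator X P (bdJumpRate lam lam al)) {k n : ℤ} (hkn : k * n < 0)
    (t : ℝ≥0) : (P k).real (noVisit X t ∩ {ω | X t ω = n}) = 0 := by
  have := hX.isProbability k
  obtain ⟨C, hC⟩ := hX.exists_measureReal_sign_change_le hlam hal
  refine le_antisymm ?_ measureReal_nonneg
  rw [← hX.measureReal_noVisit_mul_neg (one_div_pos.2 hlam) hC k t]
  refine measureReal_mono (Set.inter_subset_inter_right _ fun ω hω => ?_)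
  rw [Set.mem_ofPred_eq] at hω ⊢
  rwa [hω]

/-- In `noVisit_sub_eq` with `k' = -k`, the contribution of `-k` vanishes, since `-k` and `n` lie on
opposite sides of `0`. -/
theorem measureReal_noVisit_of_mul_pos (hlam : 0 < lam) (hal : 0 ≤ al)
    (hX : IsMarkovChainWithGenerator X P (bdJumpRate lam lam al)) {k n : ℤ} (hkn : 0 < k * n)
    (t : ℝ≥0) : (P k).real (noVisit X t ∩ {ω | X t ω = n})
      = transProb X P k n t - transProb X P (-k) n t := by
  rw [← hX.noVisit_sub_eq (hX.transProb_neg_zero hlam hal k) n t,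
    hX.measureReal_noVisit_of_mul_neg hlam hal (k := -k) (by linarith), sub_zero]

theorem avoidingProb_eq (hlam : 0 < lam) (hal : 0 ≤ al)
    (hX : IsMarkovChainWithGenerator X P (bdJumpRate lam lam al)) {k n : ℤ} (hkn : 0 < k * n)
    (t : ℝ≥0) : avoidingProb X P 0 k n t = transProb X P k n t - transProb X P (-k) n t := by
  rw [← hX.measureReal_noVisit_of_mul_pos hlam hal hkn, avoidingProb]
  refine measureReal_congr ?_
  filter_upwards [hX.start k] with ω hω
  -- The open interval `(0, t)` may be closed: at its ends the chain is at `k` and `n`, both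
  -- nonzero.
  refine propext ⟨fun h => ⟨fun θ hθ => ?_, h.1⟩, fun h => ⟨h.2, fun θ _ hθ => h.1 θ hθ.le⟩⟩
  rcases (zero_le (a := θ)).eq_or_lt with rfl | h0
  · rw [hω]; rintro rfl; simp at hkn
  · rcases hθ.eq_or_lt with rfl | hlt
    · rw [h.1]; rintro rfl; simp at hkn
    · exact h.2 θ h0 hlt

/-- Only end states on the side of the start contribute, and their avoiding probabilities form the
telescoping Bessel series. The sign `e` treats `k` and `-k` together. -/
theorem measureReal_noVisit (hlam : 0 < lam) (hal : 0 ≤ al)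
    (hX : IsMarkovChainWithGenerator X P (bdJumpRate lam lam al)) {k : ℕ} (hk : 0 < k) {e : ℤ}
    (he : e = 1 ∨ e = -1) (t : ℝ≥0) :
    (P (e * k)).real (noVisit X t) = survival lam al k t := by
  have := hX.isProbability (e * k)
  have hee : e * e = 1 := by rcases he with rfl | rfl <;> rfl
  have h := hasSum_measureReal_inter_eq (P (e * k)) (hX.measurable t) (hX.measurableSet_noVisit t)
  have hinj : Function.Injective fun j : ℕ => e * ((j : ℤ) + 1) := fun a b hab => by
    rcases he with rfl | rfl <;> simp at hab <;> omega
  rw [← hinj.hasSum_iff] at h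
  · refine h.unique (((hasSum_besselI_sub k (2 * lam * t)).mul_left
      (Real.exp (-(2 * lam + al) * t))).congr_fun fun j => ?_)
    simp only [Function.comp]
    have hpos : 0 < e * k * (e * ((j : ℤ) + 1)) := by
      rw [show e * k * (e * ((j : ℤ) + 1)) = e * e * (k * (j + 1)) by ring, hee]
      positivity
    rw [hX.measureReal_noVisit_of_mul_pos hlam hal hpos,
      hX.transProb_sub_transProb_neg hlam hal]
    have hI : ∀ m x, besselI (e * m) x = besselI m x := by
      rcases he with rfl | rfl <;> simp [besselI_neg]
    rw [← mul_sub, ← mul_add, hI, hI, besselI_sub_comm, add_comm ((j : ℤ) + 1)]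
  · intro n hn
    rcases eq_or_ne n 0 with rfl | hn0
    · convert measureReal_empty (μ := P (e * k)) using 2
      ext ω
      simp only [Set.mem_inter_iff, Set.mem_ofPred_eq, Set.mem_empty_iff_false, iff_false]
      exact fun hω => hω.1 t le_rfl hω.2
    · refine hX.measureReal_noVisit_of_mul_neg hlam hal ?_ t
      by_contra! hcon
      have hk' : (0 : ℤ) < k := by exact_mod_cast hk
      have hen : 0 ≤ e * n := by
        by_contra! hneg
        have := mul_neg_of_pos_of_neg hk' hneg
        linarith [show e * k * n = k * (e * n) by ring]
      have hen0 : e * n ≠ 0 := mul_ne_zero (by rcases he with rfl | rfl <;> norm_num) hn0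
      refine hn ⟨(e * n - 1).toNat, ?_⟩
      simp only
      rw [Int.toNat_of_nonneg (by omega), sub_add_cancel, ← mul_assoc, hee, one_mul]

theorem passageDensity_nonneg (hlam : 0 < lam) (hal : 0 ≤ al)
    (hX : IsMarkovChainWithGenerator X P (bdJumpRate lam lam al)) {k : ℕ} (hk : 0 < k) {t : ℝ}
    (ht : 0 ≤ t) : 0 ≤ passageDensity lam al k t := by
  lift t to ℝ≥0 using ht
  have h := hX.measureReal_noVisit_of_mul_pos hlam hal (k := k) (n := 1) (by simpa using hk) t
  rw [hX.transProb_sub_transProb_neg hlam hal, besselI_sub_comm, add_comm (1 : ℤ)] at h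
  -- The Bessel difference, which has no evident sign, is the probability of being at `1` without
  -- having visited `0`.
  have h1 : 0 ≤ Real.exp (-(2 * lam + al) * t)
      * (besselI (k - 1) (2 * lam * t) - besselI (k + 1) (2 * lam * t)) :=
    h ▸ measureReal_nonneg
  have h2 := besselSum_nonneg k (x := 2 * lam * t) (by positivity)
  rw [passageDensity_eq, mul_add, mul_left_comm]
  positivity

theorem hasTimeDensity_firstPassageTime (hlam : 0 < lam) (hal : 0 ≤ al)
    (hX : IsMarkovChainWithGenerator X P (bdJumpRate lam lam al)) {k : ℕ} (hk : 0 < k) {e : ℤ}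
    (he : e = 1 ∨ e = -1) :
    HasTimeDensity (P (e * k)) (firstPassageTime X 0) (passageDensity lam al k) :=
  hX.hasTimeDensity_of_survival (hX.measureReal_noVisit hlam hal hk he) (survival_zero lam al hk)
    (hasDerivAt_survival lam al k) (tendsto_survival hlam hal k)
    (measurable_passageDensity lam al k) fun _ ht => hX.passageDensity_nonneg hlam hal hk ht.le

/-- The first-passage density as the difference of the mean rates of entrance into `0`. -/
theorem passageDensity_eq_transProb (hlam : 0 < lam) (hal : 0 ≤ al)
    (hX : IsMarkovChainWithGenerator X P (bdJumpRate lam lam al)) (k : ℤ) (t : ℝ≥0) :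
    passageDensity lam al k t = lam * (transProb X P k 1 t - transProb X P k (-1) t)
      + al * ((∑' j : ℕ, transProb X P k (j + 1) t)
        - ∑' j : ℕ, transProb X P k (-(j + 1)) t) := by
  rw [← (hX.summable_transProb_comp k t (i := fun j => (j : ℤ) + 1) fun a b h => by
      simpa using h).tsum_sub (hX.summable_transProb_comp k t (i := fun j => -((j : ℤ) + 1))
      fun a b h => by simpa using h)]
  simp_rw [hX.transProb_sub_transProb_right_neg hlam hal]
  rw [tsum_mul_left, passageDensity]
  ring

/-- Index `j = 0` is the neighbour of `0`, the only state on its side that also enters `0` by an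
ordinary step. -/
theorem hasSum_transProb_mul_rate {q : ℤ → ℤ → ℝ} (hX : IsMarkovChainWithGenerator X P q)
    (mu : ℝ) (k : ℤ) (t : ℝ≥0) {i : ℕ → ℤ} (hi : Function.Injective i)
    (hrate : ∀ j, bdJumpRate lam mu al (i j) 0 = (if j = 0 then lam else 0) + al) :
    HasSum (fun j => transProb X P k (i j) t * bdJumpRate lam mu al (i j) 0)
      (lam * transProb X P k (i 0) t + al * ∑' j, transProb X P k (i j) t) := by
  have h1 := (hX.summable_transProb_comp k t hi).hasSum.mul_left al
  have h2 := hasSum_ite_eq (0 : ℕ) (lam * transProb X P k (i 0) t)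
  refine (h2.add h1).congr_fun fun j => ?_
  rw [hrate]
  by_cases hj : j = 0
  · subst hj; simp; ring
  · simp [hj]; ring

end IsMarkovChainWithGenerator

end Chain

/-! ### Assembly of the theorem -/

theorem mainTheorem5 {Ω : Type*} [MeasurableSpace Ω] (X : ℝ≥0 → Ω → ℤ) (P : ℤ → Measure Ω)
    (lam mu al : ℝ) (hlam : 0 < lam) (hmu : 0 < mu) (hal : 0 ≤ al)
    (hX : IsMarkovChainWithGenerator X P (bdJumpRate lam mu al)) :
    -- the transition probabilities
    (∀ (k n : ℤ) (t : ℝ≥0),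
      transProb X P k n t
        = (lam / mu) ^ (((n - k : ℤ) : ℝ) / 2) * besselI (n - k) (2 * Real.sqrt (lam * mu) * t)
            * Real.exp (-(lam + mu + al) * t)
          + al * (lam / mu) ^ ((n : ℝ) / 2)
            * ∫ τ in (0 : ℝ)..t, Real.exp (-(lam + mu + al) * τ)
                * besselI n (2 * Real.sqrt (lam * mu) * τ)) ∧
    (lam = mu →
      -- the first-passage-time density through `0`, from `k` and from `-k`
      (∀ k : ℤ, 0 < k →
        HasTimeDensity (P k) (firstPassageTime X 0) (passageDensity lam al k) ∧
        HasTimeDensity (P (-k)) (firstPassageTime X 0) (passageDensity lam al k) ∧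
        ∀ t : ℝ≥0, 0 < t →
          Summable (fun j : ℕ => besselI (k - (j + 1)) (2 * lam * t)
            - besselI (k + (j + 1)) (2 * lam * t)) ∧
          (∃ hdown hup : ℝ,
            IsDownwardCurrent X P k 0 t hdown ∧ IsUpwardCurrent X P k 0 t hup ∧
            HasSum (fun j : ℕ => transProb X P k (j + 1) t
              * bdJumpRate lam mu al (j + 1) 0) hdown ∧
            HasSum (fun j : ℕ => transProb X P k (-(j + 1)) t
              * bdJumpRate lam mu al (-(j + 1)) 0) hup ∧
            passageDensity lam al k t = hdown - hup) ∧
          Summable (fun j : ℕ => transProb X P k (j + 1) t) ∧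
          Summable (fun j : ℕ => transProb X P k (-(j + 1)) t) ∧
          passageDensity lam al k t
            = lam * (transProb X P k 1 t - transProb X P k (-1) t)
              + al * ((∑' j : ℕ, transProb X P k (j + 1) t)
                - ∑' j : ℕ, transProb X P k (-(j + 1)) t)) ∧
      -- the `0`-avoiding transition probabilities, for `k` and `n` on the same side of `0`
      (∀ k n : ℤ, 0 < k * n → ∀ t : ℝ≥0, 0 < t →
        avoidingProb X P 0 k n t = transProb X P k n t - transProb X P (-k) n t ∧
        avoidingProb X P 0 k n t
          = Real.exp (-(2 * lam + al) * t)
            * (besselI (n - k) (2 * lam * t) - besselI (n + k) (2 * lam * t)))) := by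
  refine ⟨fun k n t => ?_, ?_⟩
  · rw [hX.transProb_eq hlam hmu hal, walkProb, jumpProb, ← intervalIntegral.integral_const_mul]
    congr 2
    funext τ
    rw [walkProb]
    ring
  rintro rfl
  have hup : ∀ j : ℕ, bdJumpRate lam lam al (j + 1) 0 = (if j = 0 then lam else 0) + al := by
    intro j
    have h1 : (0 : ℤ) ≠ (j : ℤ) + 1 + 1 := by omega
    have h2 : (0 : ℤ) ≠ (j : ℤ) + 1 := by omega
    have h3 : (0 : ℤ) = j + 1 - 1 ↔ j = 0 := by omega
    simp only [bdJumpRate_eq, h1, h2, h3, if_true, if_false]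
    ring
  have hdn : ∀ j : ℕ, bdJumpRate lam lam al (-(j + 1)) 0 = (if j = 0 then lam else 0) + al := by
    intro j
    have h1 : (0 : ℤ) ≠ -((j : ℤ) + 1) - 1 := by omega
    have h2 : (0 : ℤ) ≠ -((j : ℤ) + 1) := by omega
    have h3 : (0 : ℤ) = -((j : ℤ) + 1) + 1 ↔ j = 0 := by omega
    simp only [bdJumpRate_eq, h1, h2, h3, if_true, if_false]
    ring
  have hinj : Function.Injective fun j : ℕ => (j : ℤ) + 1 := fun a b h => by simpa using h
  have hinj' : Function.Injective fun j : ℕ => -((j : ℤ) + 1) := fun a b h => by simpa using h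
  refine ⟨fun k hk => ?_, fun k n hkn t _ => ?_⟩
  · lift k to ℕ using hk.le
    have hk' : 0 < k := by exact_mod_cast hk
    refine ⟨?_, ?_, fun t _ => ⟨(hasSum_besselI_sub k _).summable, ?_,
      hX.summable_transProb_comp k t hinj, hX.summable_transProb_comp k t hinj',
      hX.passageDensity_eq_transProb hlam hal k t⟩⟩
    · simpa using hX.hasTimeDensity_firstPassageTime hlam hal hk' (e := 1) (Or.inl rfl)
    · simpa using hX.hasTimeDensity_firstPassageTime hlam hal hk' (e := -1) (Or.inr rfl)
    · have hC := fun (m : ℤ) (τ : ℝ≥0) (hm : m ≠ 0) (hτ : (τ : ℝ) ≤ 1 / lam) =>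
        hX.transProb_self_zero_le hlam hal hm hτ
      have s1 := hX.hasSum_transProb_mul_rate lam k t hinj hup
      have s2 := hX.hasSum_transProb_mul_rate lam k t hinj' hdn
      have c1 := hX.tendsto_current (one_div_pos.2 hlam) hC k t hinj (fun j => by omega)
        {m | 0 < m} fun m => ⟨fun hm => ⟨(m - 1).toNat, by
          have : 0 < m := hm
          simp only; omega⟩, by rintro ⟨j, rfl⟩; exact Int.natCast_succ_pos j⟩
      have c2 := hX.tendsto_current (one_div_pos.2 hlam) hC k t hinj' (fun j => by omega)
        {m | m < 0} fun m => ⟨fun hm => ⟨(-m - 1).toNat, by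
          have : m < 0 := hm
          simp only; omega⟩, by rintro ⟨j, rfl⟩; exact neg_lt_zero.2 (Int.natCast_succ_pos j)⟩
      refine ⟨_, _, by rwa [s1.tsum_eq] at c1, by rwa [s2.tsum_eq] at c2, s1, s2, ?_⟩
      rw [hX.passageDensity_eq_transProb hlam hal]
      simp only [Nat.cast_zero, zero_add]
      ring
  · rw [hX.avoidingProb_eq hlam hal hkn, hX.transProb_sub_transProb_neg hlam hal]
    exact ⟨rfl, rfl⟩
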